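/- **Setting.** The read/write client of an oblivious synchronized block filesystem has parameters $B$ (even; size in bytes of a backend file, which is a pair of two blocks of $B/2$ bytes), $N$ (number of backend block pairs), $k$ with $1\le k\le N$ (drip rate), a bound $n$ on the number of frontend files, and a drip time $\tau>0$. Each file, including the directory file, is split into fragments of $B/2$ bytes (the last one may be smaller). A non-read operation (create, delete, resize, write) puts the changed fragments into a pending-writes buffer. At the times $\tau,2\tau,3\tau,\dots$ a *sync* takes place: a uniformly random set of $k$ block pairs is chosen, independently of the past; stale fragments in them (those whose block is in neither the current nor the published block-id list of their file) are dropped; the small fragments of each pair are combined into one block if they fit; then the buffered fragments, those of the directory file first and otherwise in FIFO order, are placed first-fit (full-block fragments in empty blocks, small fragments in split blocks with enough room, else in an empty block); the block-id list of a file is published once none of its fragments is pending; published entries that changed go to a bounded cache in a superblock, and on overflow the cached entries of the most common leaf node of the file table are removed and this node (of the size of a block) is put into the buffer. On the next timer tick the superblock and the $k$ chosen pairs, serialized to bit strings of fixed lengths and freshly encrypted, are written to the backend. An $(L,t)$-fsequence is a sequence of non-read operations in order of time, all at times in $[0,t]$, for which the total number of bytes of fragments (file data, directory file, file-table leaf nodes)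 put into the buffer is at most $L$, whatever the random choices. The access pattern is the list of all writes to the backend, each with its time, file and ciphertext, preceded by an encrypted snapshot of the whole backend at time $0$. **Theorem.** Let $\lambda$ be the security parameter. Let the encryption scheme be IND-CPA secure (left-or-right form, polynomial-size circuit adversaries). Let $B,N,k,n,\tau,L\in\mathbb N$ and $t\ge 0$ be given (they may depend on $\lambda$), with $N$ and the lengths of the serialized block pairs and superblock polynomially bounded in $\lambda$. Let the client start at time $0$ in a state that is reachable from the empty filesystem, with an empty buffer and with $m$ bytes of non-stale data in the backend, where $m+L\le NB/4$. Then the client is a write-only strongly-oblivious block filesystem for $(L,t)$-fsequences with running time $$T=t+\frac{48L\tau}{Bk}+18\lambda\tau ,$$ that is, $T=t+\frac{48Lt}{Bk}+18\lambda t$ if the drip time is $\tau=t$. Concretely, for any two families $P_0,P_1$ of $(L,t)$-fsequences: 1. for each of $P_0$ and $P_1$, except with probability negligible in $\lambda$, all operations are finished within time $T$: after some sync that follows all operations the buffer is empty and the published file table is up to date, and the output of this sync has been written to the backend by time $T$; 2. for every polynomially bounded number of syncs, the access patterns of $P_0$ and $P_1$ during these syncs are computationally indistinguishable (by polynomial-size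 circuits). -/

import Mathlib

namespace ObliviSync

/-! ## Asymptotic notions and non-uniform (circuit) adversaries -/

/-- Negligible functions of the security parameter. -/
def Negligible (f : ℕ → ℝ) : Prop :=
  Asymptotics.SuperpolynomialDecay Filter.atTop (fun sec : ℕ => (sec : ℝ)) f

/-- Functions of the security parameter that are bounded by a polynomial. -/
def PolyBounded (f : ℕ → ℕ) : Prop :=
  ∃ q : Polynomial ℕ, ∀ sec, f sec ≤ q.eval sec

/-- A gate of a Boolean circuit whose input atoms are named by `α`; a NAND gate refers to
two earlier gates by their position. -/
inductive Gate (α : Type) where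
  | input (a : α)
  | const (b : Bool)
  | nand (i j : ℕ)

def Gate.eval {α : Type} (ρ : α → Bool) (vs : List Bool) : Gate α → Bool
  | .input a => ρ a
  | .const b => b
  | .nand i j => !(vs.getD i false && vs.getD j false)

/-- The values of all gates, computed in order. -/
def evalGates {α : Type} (ρ : α → Bool) (gs : List (Gate α)) : List Bool :=
  gs.foldl (fun vs g => vs ++ [g.eval ρ vs]) []

/-- A Boolean circuit with one output gate. -/
structure Circuit (α : Type) where
  gates : List (Gate α)
  out : ℕ

def Circuit.size {α : Type} (C : Circuit α) : ℕ := C.gates.length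

def Circuit.eval {α : Type} (C : Circuit α) (ρ : α → Bool) : Bool :=
  (evalGates ρ C.gates).getD C.out false

/-! ## Symmetric encryption and IND-CPA security -/

/-- A symmetric encryption scheme on bit strings. -/
structure SymEnc where
  Key : ℕ → Type
  gen : (sec : ℕ) → PMF (Key sec)
  enc : (sec : ℕ) → Key sec → List Bool → PMF (List Bool)
  dec : (sec : ℕ) → Key sec → List Bool → Option (List Bool)
  correct : ∀ sec, ∀ κ ∈ (gen sec).support, ∀ m, ∀ c ∈ (enc sec κ m).support,
    dec sec κ c = some m

/-- Input atoms of a chosen-plaintext adversary: `(a, i, v)` asks whether the `i`-th bit of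
the answer to query `a` exists and equals `v`. -/
abbrev CPAAtom := ℕ × ℕ × Bool

def cpaInput (answers : List (List Bool)) : CPAAtom → Bool
  | (a, i, v) => decide ((answers.getD a [])[i]? = some v)

/-- A left-or-right query: a circuit computes, from the ciphertexts received so far, two
messages of the same length. -/
structure LRQuery where
  gates : List (Gate CPAAtom)
  left : List ℕ
  right : List ℕ
  same_length : left.length = right.length

/-- The left (`side = false`) or right (`side = true`) message of a query. -/
def LRQuery.message (q : LRQuery) (side : Bool) (answers : List (List Bool)) : List Bool :=
  let vs := evalGates (cpaInput answers) q.gates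
  (if side then q.right else q.left).map fun w => vs.getD w false

/-- A chosen-plaintext adversary: adaptive left-or-right queries, then a guess. -/
structure CPAAdversary where
  queries : List LRQuery
  guess : Circuit CPAAtom

def CPAAdversary.size (A : CPAAdversary) : ℕ :=
  (A.queries.map fun q => 1 + q.gates.length + q.left.length + q.right.length).sum
    + A.guess.size

noncomputable section

/-- The answers of the left-or-right encryption oracle with a given key and side. -/
def SymEnc.oracle (E : SymEnc) (sec : ℕ) (κ : E.Key sec) (side : Bool) :
    List LRQuery → List (List Bool) → PMF (List (List Bool))
  | [], answers => PMF.pure answers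
  | q :: qs, answers =>
      (E.enc sec κ (q.message side answers)).bind fun c =>
        E.oracle sec κ side qs (answers ++ [c])

/-- The adversary's output in the game with a given side. -/
def SymEnc.cpaGame (E : SymEnc) (sec : ℕ) (A : CPAAdversary) (side : Bool) : PMF Bool :=
  (E.gen sec).bind fun κ =>
    (E.oracle sec κ side A.queries []).map fun answers => A.guess.eval (cpaInput answers)

/-- IND-CPA security in its left-or-right form, against polynomial-size adversaries. -/
def SymEnc.INDCPA (E : SymEnc) : Prop :=
  ∀ A : ℕ → CPAAdversary, PolyBounded (fun sec => (A sec).size) →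
    Negligible fun sec =>
      |(E.cpaGame sec (A sec) false true).toReal - (E.cpaGame sec (A sec) true true).toReal|

end

/-! ## Parameters and data of the block filesystem -/

/-- Parameters of the read/write client. -/
structure Params where
  /-- block size in bytes; a backend file is a pair of blocks -/
  blk : ℕ
  /-- number of backend block pairs (besides the superblock) -/
  N : ℕ
  /-- drip rate: number of block pairs rewritten in each sync -/
  k : ℕ
  /-- maximal number of frontend files (file-ids are `0, …, n - 1`) -/
  n : ℕ
  /-- number of file-entries that the cache in the superblock can hold -/
  cacheCap : ℕ
  /-- number of consecutive file-ids whose entries share a leaf of the filetable B-tree -/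
  leafCap : ℕ
  blk_pos : 0 < blk
  k_pos : 0 < k
  k_le : k ≤ N

/-- Size in bytes of a backend file (block pair). -/
def Params.B (p : Params) : ℕ := 2 * p.blk

abbrev Byte := UInt8

abbrev Name := List Byte

/-- A block-id: the block pair, and which of its two blocks. -/
abbrev BlockId (p : Params) := Fin p.N × Bool

/-- A file-entry: file size in bytes and the block-ids of the fragments in order; `none`
plays the role of a negative block-id (the fragment is not available in the backend). -/
structure Entry (p : Params) where
  size : ℕ
  locs : List (Option (BlockId p))
deriving DecidableEq

/-- A logical file as seen in the frontend, split into fragments; all fragments but the last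
have the size of a block. `none` is a fragment that was added by enlarging the file and has
never been written. -/
structure FileData where
  size : ℕ
  frags : List (Option (List Byte))

/-- An element of the pending writes buffer: a fragment of a file (directory files
included), or a leaf node of the filetable. -/
inductive Pending (p : Params) where
  | data (fid idx : ℕ) (bytes : List Byte)
  | leaf (l : ℕ) (entries : List (ℕ × Entry p))

/-- Size in bytes; a leaf node has exactly the size of a block. -/
def Pending.size {p : Params} : Pending p → ℕ
  | .data _ _ d => d.length
  | .leaf _ _ => p.blk

def Pending.isFile {p : Params} (f : ℕ) : Pending p → Bool
  | .data fid _ _ => fid == f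
  | .leaf _ _ => false

def Pending.isLeaf {p : Params} (l' : ℕ) : Pending p → Bool
  | .data _ _ _ => false
  | .leaf l _ => l == l'

/-- A backend block: empty, a full block with one file fragment, a leaf node of the
filetable, or a split block with several small fragments (tagged with their file-ids). -/
inductive Block (p : Params) where
  | empty
  | full (fid : ℕ) (bytes : List Byte)
  | leaf (l : ℕ) (entries : List (ℕ × Entry p))
  | split (frags : List (ℕ × List Byte))

def fragsSize (xs : List (ℕ × List Byte)) : ℕ := (xs.map fun x => x.2.length).sum

/-- Number of bytes stored in a block. -/
def Block.used {p : Params} : Block p → ℕ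
  | .empty => 0
  | .full _ d => d.length
  | .leaf _ _ => p.blk
  | .split xs => fragsSize xs

def Block.isEmpty {p : Params} : Block p → Bool
  | .empty => true
  | _ => false

/-- A split block with room for `len` more bytes. -/
def Block.hasRoom {p : Params} (len : ℕ) : Block p → Bool
  | .split xs => decide (fragsSize xs + len ≤ p.blk)
  | _ => false

def Block.addFrag {p : Params} (x : ℕ × List Byte) : Block p → Block p
  | .split xs => .split (xs ++ [x])
  | _ => .split [x]

/-- What the superblock stores: the cached file-entries and the root node of the filetable. -/
structure Superblock (p : Params) where
  cache : ℕ → Option (Entry p)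
  root : ℕ → Option (BlockId p)

/-- Serialization of a directory listing to the bytes of the directory file, and of block
pairs and the superblock to bit strings of fixed lengths. -/
structure Format (p : Params) where
  dirBytes : List (Name × ℕ) → List Byte
  pairLen : ℕ
  pairBits : Block p → Block p → List Bool
  pairBits_length : ∀ a b, (pairBits a b).length = pairLen
  superLen : ℕ
  superBits : Superblock p → List Bool
  superBits_length : ∀ s, (superBits s).length = superLen

/-- The state of the read/write client together with the (decrypted) backend. -/
structure State (p : Params) where
  /-- the root directory: file names and file-ids -/
  dir : List (Name × ℕ)
  /-- the logical files; file-id `0` is the directory file -/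
  files : ℕ → Option FileData
  /-- the pending writes buffer, oldest first -/
  buffer : List (Pending p)
  /-- the contents of the backend blocks -/
  backend : BlockId p → Block p
  /-- the client's current filetable -/
  table : ℕ → Option (Entry p)
  /-- the shadow filetable: for each file the most recent completely synced entry -/
  published : ℕ → Option (Entry p)
  /-- file-ids whose entries are in the file-entry cache -/
  cache : Finset ℕ
  /-- root node of the filetable: the block-ids of the leaf nodes -/
  root : ℕ → Option (BlockId p)
  /-- bookkeeping only: total number of bytes that ever entered the buffer -/
  modified : ℕ

/-- The freshly initialized filesystem, with an empty directory. -/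
def State.init (p : Params) : State p where
  dir := []
  files := fun f => if f = 0 then some ⟨0, []⟩ else none
  buffer := []
  backend := fun _ => .empty
  table := fun f => if f = 0 then some ⟨0, []⟩ else none
  published := fun f => if f = 0 then some ⟨0, []⟩ else none
  cache := {0}
  root := fun _ => none
  modified := 0

/-! ## The non-read operations -/

inductive Op where
  | create (name : Name)
  | delete (name : Name)
  | resize (name : Name) (size : ℕ)
  /-- write `bytes` starting at the block with number `offset` -/
  | write (name : Name) (offset : ℕ) (bytes : List Byte)

def numFrags (p : Params) (size : ℕ) : ℕ := (size + p.blk - 1) / p.blk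

def fragLen (p : Params) (size i : ℕ) : ℕ := min p.blk (size - i * p.blk)

/-- Truncate, or pad with zero bytes, to a given length. -/
def fit (len : ℕ) (d : List Byte) : List Byte := (d ++ List.replicate len 0).take len

/-- Replace the contents of file `f`. The fragments that really change, and only these, enter
the buffer (superseding pending older versions) and lose their block-ids in the current
filetable. A file that needs more than the `2 N` blocks of the backend is refused. -/
def State.put {p : Params} (σ : State p) (f size : ℕ) (new : List (Option (List Byte))) :
    State p :=
  let old := ((σ.files f).map FileData.frags).getD []
  let oldLocs := ((σ.table f).map Entry.locs).getD []
  let changed : ℕ → Bool := fun i => decide (new[i]? ≠ old[i]?)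
  let fresh : List (Pending p) := (List.range new.length).filterMap fun i =>
    if changed i then (new.getD i none).map (Pending.data f i) else none
  let keep : Pending p → Bool := fun x => match x with
    | .data fid i _ => decide (fid ≠ f) || (decide (i < new.length) && !changed i)
    | .leaf _ _ => true
  { σ with
    files := Function.update σ.files f (some ⟨size, new⟩)
    buffer := σ.buffer.filter keep ++ fresh
    table := Function.update σ.table f (some ⟨size, (List.range new.length).map fun i =>
      if changed i then none else oldLocs.getD i none⟩)
    modified := σ.modified + (fresh.map Pending.size).sum }

/-- Split a byte string into fragments. -/
def chunks (p : Params) (d : List Byte) : List (Option (List Byte)) :=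
  (List.range (numFrags p d.length)).map fun i => some ((d.drop (i * p.blk)).take p.blk)

/-- Store a directory listing, in the client and in the directory file. -/
def State.putDir {p : Params} (fmt : Format p) (σ : State p) (dir : List (Name × ℕ)) :
    State p :=
  let d := fmt.dirBytes dir
  { σ.put 0 d.length (chunks p d) with dir := dir }

/-- Whether a file with `size` bytes is small enough to be stored at all. -/
def fits (p : Params) (size : ℕ) : Bool := decide (numFrags p size ≤ 2 * p.N)

def State.lookup {p : Params} (σ : State p) (name : Name) : Option ℕ :=
  (σ.dir.find? fun x => decide (x.1 = name)).map Prod.snd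

/-- The effect of an operation on the client. An operation that makes no sense (a file that
does not exist or exists already, no free file-id, too large a file) has no effect. -/
def State.apply {p : Params} (fmt : Format p) (σ : State p) : Op → State p
  | .create name =>
    match σ.lookup name, (List.range p.n).find? fun f =>
        decide (f ≠ 0) && (σ.files f).isNone && (σ.published f).isNone with
    | none, some f =>
      let dir := σ.dir ++ [(name, f)]
      if fits p (fmt.dirBytes dir).length then
        State.putDir fmt { σ with
          files := Function.update σ.files f (some ⟨0, []⟩)
          table := Function.update σ.table f (some ⟨0, []⟩) } dir
      else σ
    | _, _ => σ
  | .delete name =>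
    match σ.lookup name with
    | some f =>
      let dir := σ.dir.filter fun x => decide (x.1 ≠ name)
      if fits p (fmt.dirBytes dir).length then
        State.putDir fmt { σ with
          files := Function.update σ.files f none
          table := Function.update σ.table f none
          buffer := σ.buffer.filter fun x => !x.isFile f } dir
      else σ
    | none => σ
  | .resize name size =>
    match σ.lookup name with
    | some f =>
      if fits p size then
        let old := ((σ.files f).map FileData.frags).getD []
        σ.put f size ((List.range (numFrags p size)).map fun i =>
          (old.getD i none).map (fit (fragLen p size i)))
      else σ
    | none => σ
  | .write name offset bytes =>
    match σ.lookup name with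
    | some f =>
      let oldSize := ((σ.files f).map FileData.size).getD 0
      let old := ((σ.files f).map FileData.frags).getD []
      let size := max oldSize (offset * p.blk + bytes.length)
      if bytes ≠ [] ∧ fits p size then
        σ.put f size ((List.range (numFrags p size)).map fun i =>
          let base := (old.getD i none).map (fit (fragLen p size i))
          if offset ≤ i ∧ i * p.blk < offset * p.blk + bytes.length then
            let chunk := (bytes.drop ((i - offset) * p.blk)).take p.blk
            some (chunk ++ ((base.getD (List.replicate (fragLen p size i) 0)).drop chunk.length))
          else base)
      else σ
    | none => σ

/-! ## Staleness and the sync operation -/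

/-- File `f` refers to one of the blocks selected by `sel`, in its current or in its shadow
file-entry. -/
def State.refers {p : Params} (σ : State p) (f : ℕ) (sel : BlockId p → Bool) : Bool :=
  [σ.table f, σ.published f].any fun e =>
    ((e.map Entry.locs).getD []).any fun o => (o.map sel).getD false

/-- The contents of a block without its stale fragments. A fragment is stale if the block is
not in the block-id list of its file; small fragments may reside in either block of the pair
given by their block-id. -/
def State.live {p : Params} (σ : State p) (β : BlockId p) : Block p :=
  match σ.backend β with
  | .empty => .empty
  | .full f d => if σ.refers f (fun γ => decide (γ = β)) then .full f d else .empty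
  | .leaf l es => if σ.root l = some β then .leaf l es else .empty
  | .split xs =>
    let ys := xs.filter fun x => σ.refers x.1 fun γ => decide (γ.1 = β.1)
    if ys.isEmpty then .empty else .split ys

/-- Total size in bytes of the non-stale data in the backend. -/
def State.liveBytes {p : Params} (σ : State p) : ℕ := ∑ β : BlockId p, (σ.live β).used

/-- Placement of the non-stale fragments of a chosen pair: full blocks stay where they are,
and the small fragments are combined into one split block if they fit. -/
def State.repack {p : Params} (σ : State p) (q : Fin p.N) : Block p × Block p :=
  match σ.live (q, false), σ.live (q, true) with
  | .split xs, .split ys =>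
    if fragsSize xs + fragsSize ys ≤ p.blk then (.split (xs ++ ys), .empty)
    else (.split xs, .split ys)
  | a, b => (a, b)

/-- The block, among the chosen ones, into which a pending fragment goes (if any), with the new
contents of that block. -/
def place {p : Params} (ids : List (BlockId p)) (bk : BlockId p → Block p) :
    Pending p → Option (BlockId p × Block p)
  | .leaf l es => (ids.find? fun β => (bk β).isEmpty).map fun β => (β, .leaf l es)
  | .data f _ d =>
    if d.length = p.blk then
      (ids.find? fun β => (bk β).isEmpty).map fun β => (β, .full f d)
    else
      match ids.find? fun β => (bk β).hasRoom d.length with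
      | some β => some (β, (bk β).addFrag (f, d))
      | none => (ids.find? fun β => (bk β).isEmpty).map fun β => (β, .split [(f, d)])

/-- Try to clear one fragment from the buffer; `buffer` collects those that remain. -/
def State.push {p : Params} (ids : List (BlockId p)) (σ : State p) (x : Pending p) : State p :=
  match place ids σ.backend x with
  | none => { σ with buffer := σ.buffer ++ [x] }
  | some (β, b) =>
    match x with
    | .data f i _ =>
      { σ with
        backend := Function.update σ.backend β b
        table := Function.update σ.table f
          ((σ.table f).map fun e => { e with locs := e.locs.set i (some β) }) }
    | .leaf l _ =>
      { σ with
        backend := Function.update σ.backend β b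
        root := Function.update σ.root l (some β) }

/-- Publish the entries of all files without pending fragments; changed entries enter the
cache. -/
def State.publish {p : Params} (σ : State p) : State p :=
  let pub : ℕ → Option (Entry p) := fun f =>
    if σ.buffer.any (Pending.isFile f) then σ.published f else σ.table f
  { σ with
    published := pub
    cache := σ.cache ∪ (Finset.range p.n).filter fun f => pub f ≠ σ.published f }

/-- If the cache is too large, the entries that belong to the most common leaf node are removed
from it and the leaf node is written (through the buffer). -/
def State.evictOnce {p : Params} (σ : State p) : State p :=
  if σ.cache.card ≤ p.cacheCap then σ else
    match (List.range p.n).argmax fun l => (σ.cache.filter fun f => f / p.leafCap = l).card with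
    | none => σ
    | some l =>
      { σ with
        cache := σ.cache.filter fun f => f / p.leafCap ≠ l
        buffer := (σ.buffer.filter fun x => !x.isLeaf l) ++
          [.leaf l ((List.range p.n).filterMap fun f =>
            if f / p.leafCap = l then (σ.published f).map fun e => (f, e) else none)]
        modified := σ.modified + p.blk }

/-- Evict until the cache is small enough. -/
def State.evict {p : Params} (σ : State p) : State p :=
  State.evictOnce^[σ.cache.card] σ

/-- The possible choices of the block pairs in a sync: sets of `k` pairs. -/
abbrev Choice (p : Params) := {S : Finset (Fin p.N) // S.card = p.k}

instance (p : Params) : Nonempty (Choice p) := by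
  obtain ⟨S, -, hS⟩ := Finset.exists_subset_card_eq
    (s := (Finset.univ : Finset (Fin p.N))) (n := p.k) (by simpa using p.k_le)
  exact ⟨⟨S, hS⟩⟩

/-- The sync operation on the chosen pairs: remove stale data and re-pack, push directory
fragments and then all other fragments in FIFO order, publish, and evict. -/
def State.sync {p : Params} (σ : State p) (S : Choice p) : State p :=
  let ids : List (BlockId p) := (S.1.sort (· ≤ ·)).flatMap fun q => [(q, false), (q, true)]
  let σ₁ : State p := { σ with
    buffer := []
    backend := fun β =>
      if β.1 ∈ S.1 then (if β.2 then (σ.repack β.1).2 else (σ.repack β.1).1)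
      else σ.backend β }
  let queue := (σ.buffer.filter fun x => x.isFile 0) ++ (σ.buffer.filter fun x => !x.isFile 0)
  (queue.foldl (State.push ids) σ₁).publish.evict

/-- States of a running client. -/
inductive Reachable {p : Params} (fmt : Format p) : State p → Prop
  | init : Reachable fmt (State.init p)
  | op (σ : State p) (o : Op) : Reachable fmt σ → Reachable fmt (σ.apply fmt o)
  | sync (σ : State p) (S : Choice p) : Reachable fmt σ → Reachable fmt (σ.sync S)

def State.superblock {p : Params} (σ : State p) : Superblock p where
  cache := fun f => if f ∈ σ.cache then σ.published f else none
  root := σ.root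

/-! ## Timed runs, fsequences, access patterns -/

/-- A non-read operation and the time at which it takes place. -/
structure TimedOp where
  time : ℝ
  op : Op

/-- A write to the backend as seen by the cloud service: the time, the backend file (`none` is
the superblock, `some q` the block pair `q`), and the bit string written. -/
structure Access (p : Params) where
  time : ℝ
  file : Option (Fin p.N)
  payload : List Bool

/-- Input atoms of a distinguisher that reads a list of accesses. -/
inductive AccessAtom (p : Params) where
  /-- is there an `a`-th access? -/
  | present (a : ℕ)
  /-- does the `a`-th access take place at time `x`? -/
  | time (a : ℕ) (x : ℝ)
  /-- does the `a`-th access write the given file? -/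
  | file (a : ℕ) (f : Option (Fin p.N))
  /-- does the `i`-th bit written by the `a`-th access exist and equal `v`? -/
  | bit (a i : ℕ) (v : Bool)

noncomputable section

open Classical in
def accessInput {p : Params} (w : List (Access p)) : AccessAtom p → Bool
  | .present a => decide (a < w.length)
  | .time a x => decide (w[a]?.map Access.time = some x)
  | .file a f => decide (w[a]?.map Access.file = some f)
  | .bit a i v => decide ((w[a]?.bind fun e => e.payload[i]?) = some v)

/-- The state after the first `j` syncs; with drip time `τ` the `j`-th sync is at time `j * τ`
and the operations at times in `[j * τ, (j + 1) * τ)` come between the syncs `j` and `j + 1`. -/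
def run {p : Params} (fmt : Format p) (σ : State p) (τ : ℝ) (P : List TimedOp) {J : ℕ}
    (ω : Fin J → Choice p) : ℕ → State p
  | 0 => σ
  | j + 1 =>
    if h : j < J then
      (((P.filter fun o => decide (j * τ ≤ o.time ∧ o.time < (j + 1) * τ)).map TimedOp.op).foldl
        (State.apply fmt) (run fmt σ τ P ω j)).sync (ω ⟨j, h⟩)
    else run fmt σ τ P ω j

/-- `(L, t)`-fsequences for a client in state `σ`: the operations come in the order of their
times, the last one at time at most `t`, and at most `L` bytes of file data and of filesystem
metadata (directory files and filetable leaf nodes) have to be written on their behalf, whatever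
the random choices of the syncs are. -/
structure IsFSequence {p : Params} (fmt : Format p) (σ : State p) (τ : ℝ) (L : ℕ) (t : ℝ)
    (P : List TimedOp) : Prop where
  sorted : P.Pairwise fun a b => a.time ≤ b.time
  nonneg : ∀ o ∈ P, 0 ≤ o.time
  le : ∀ o ∈ P, o.time ≤ t
  bytes : ∀ (J : ℕ) (ω : Fin J → Choice p),
    (run fmt σ τ P ω J).modified ≤ σ.modified + L

/-- All tasks are finished within time `T`: after some sync that follows all operations the
buffer is empty and the published filetable is up to date, and the output of this sync, which is
written to the backend on the next timer tick, has been written by time `T`. -/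
def FinishedWithin {p : Params} (fmt : Format p) (σ : State p) (τ : ℝ) (P : List TimedOp) {J : ℕ}
    (T : ℝ) (ω : Fin J → Choice p) : Prop :=
  ∃ j ≤ J, ((j : ℝ) + 1) * τ ≤ T ∧ (∀ o ∈ P, o.time < j * τ) ∧
    (run fmt σ τ P ω j).buffer = [] ∧
    (run fmt σ τ P ω j).published = (run fmt σ τ P ω j).table

/-- The probability that the tasks are not finished within time `T`; the choices in different
syncs are independent and uniform. -/
def failureProb {p : Params} (fmt : Format p) (σ : State p) (τ : ℝ) (P : List TimedOp) (T : ℝ) :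
    ℝ :=
  ((PMF.uniformOfFintype (Fin ⌊T / τ⌋₊ → Choice p)).toOuterMeasure
    {ω | ¬ FinishedWithin fmt σ τ P T ω}).toReal

def pairAccess {p : Params} (fmt : Format p) (σ : State p) (x : ℝ) (q : Fin p.N) : Access p :=
  ⟨x, some q, fmt.pairBits (σ.backend (q, false)) (σ.backend (q, true))⟩

def superAccess {p : Params} (fmt : Format p) (σ : State p) (x : ℝ) : Access p :=
  ⟨x, none, fmt.superBits σ.superblock⟩

/-- The accesses before encryption: the whole backend at time `0`, then for each sync the
superblock and the chosen pairs, written on the timer tick that follows the sync. -/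
def plainAccesses {p : Params} (fmt : Format p) (σ : State p) (τ : ℝ) (P : List TimedOp) {J : ℕ}
    (ω : Fin J → Choice p) : List (Access p) :=
  (superAccess fmt σ 0 :: (List.finRange p.N).map (pairAccess fmt σ 0)) ++
    (List.finRange J).flatMap fun (j : Fin J) =>
      let σ' := run fmt σ τ P ω (j + 1)
      let x : ℝ := ((j : ℕ) + 2) * τ
      superAccess fmt σ' x :: ((ω j).1.sort (· ≤ ·)).map (pairAccess fmt σ' x)

/-- Encrypt the payloads one after the other, with fresh randomness. -/
def encryptAll (E : SymEnc) (sec : ℕ) (κ : E.Key sec) {p : Params} :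
    List (Access p) → PMF (List (Access p))
  | [] => PMF.pure []
  | a :: as =>
    (E.enc sec κ a.payload).bind fun c =>
      (encryptAll E sec κ as).map fun cs => ⟨a.time, a.file, c⟩ :: cs

/-- The access pattern during the first `J` syncs. -/
def accessPattern (E : SymEnc) (sec : ℕ) {p : Params} (fmt : Format p) (σ : State p) (τ : ℝ)
    (P : List TimedOp) (J : ℕ) : PMF (List (Access p)) :=
  (E.gen sec).bind fun κ =>
    (PMF.uniformOfFintype (Fin J → Choice p)).bind fun ω =>
      encryptAll E sec κ (plainAccesses fmt σ τ P ω)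

/-- Computational indistinguishability of two families of random access patterns. -/
def CompIndist {p : ℕ → Params} (X Y : (sec : ℕ) → PMF (List (Access (p sec)))) : Prop :=
  ∀ D : (sec : ℕ) → Circuit (AccessAtom (p sec)), PolyBounded (fun sec => (D sec).size) →
    Negligible fun sec =>
      |(((X sec).map fun w => (D sec).eval (accessInput w)) true).toReal -
        (((Y sec).map fun w => (D sec).eval (accessInput w)) true).toReal|

/-- A read/write client: for each security parameter the parameters, serialization formats, the
state in which it runs at time `0`, and the drip time. -/
structure Client where
  scheme : SymEnc
  par : ℕ → Params
  fmt : (sec : ℕ) → Format (par sec)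
  start : (sec : ℕ) → State (par sec)
  drip : ℕ → ℝ

/-- Write-only strong obliviousness with running time `T` for `(L, t)`-fsequences. The access
patterns are compared over every polynomial number of syncs. -/
def Client.WriteOnlyStronglyOblivious (C : Client) (L : ℕ → ℕ) (t T : ℕ → ℝ) : Prop :=
  ∀ P₀ P₁ : ℕ → List TimedOp,
    (∀ sec, IsFSequence (C.fmt sec) (C.start sec) (C.drip sec) (L sec) (t sec) (P₀ sec)) →
    (∀ sec, IsFSequence (C.fmt sec) (C.start sec) (C.drip sec) (L sec) (t sec) (P₁ sec)) →
    (Negligible fun sec =>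
      failureProb (C.fmt sec) (C.start sec) (C.drip sec) (P₀ sec) (T sec)) ∧
    (Negligible fun sec =>
      failureProb (C.fmt sec) (C.start sec) (C.drip sec) (P₁ sec) (T sec)) ∧
    ∀ J : ℕ → ℕ, PolyBounded J →
      CompIndist
        (fun sec => accessPattern C.scheme sec (C.fmt sec) (C.start sec) (C.drip sec)
          (P₀ sec) (J sec))
        (fun sec => accessPattern C.scheme sec (C.fmt sec) (C.start sec) (C.drip sec)
          (P₁ sec) (J sec))

end

end ObliviSync

namespace ObliviSync

variable {p : Params}

/-! ## Bookkeeping: pending bytes, references, live bytes -/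

/-! Running time. Call a pair good if cleaning and repacking it leaves an empty block. A pair that
is not good holds at least one block of live data: it contains a full block or a leaf node, or two
split blocks too large to be combined. Live plus pending bytes never exceed the initial live data
plus `L` (`run_liveBytes`), so by the capacity hypothesis at least half of all pairs are good in
every state of the run (`State.le_two_mul_card_goodPairs`).

Once the operations are over, a sync that leaves something pending normally fills every empty chosen
block at least half: a small leftover fragment would otherwise have been placed, and if all
fragments are large, a single one suffices. There are two exceptions: a sync that leaves only large
fragments for the first time, and one that clears the buffer before evictions refill it. Neither
recurs, since evictions add only leaf nodes of full block size and nothing remains to be published.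
So twice the pending bytes, plus `k * blk` for each exception still to come, is a potential that
drops by `blk` per good chosen pair, up to bytes newly put into the buffer (`State.sync_progress`).
While the buffer stays nonempty, good pairs are thus chosen at most `2 L / blk + 2 k` times
(`sum_gain_le_of_pending`).

Given the past, a uniform choice hits at least `k / 2` good pairs on average. If it hits `g` of
them, the weight `1 - g / (2 k)` therefore has conditional mean at most `3/4`, and the product of
these weights over `M` syncs has mean at most `(3/4)^M` (`sum_prod_weight_le`). Failure forces the
product to be at least `2^(-(z + 2))` with `z = 2 L / (blk * k)`. Markov's inequality with `M ≥ 12 z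
+ 18 λ - 3` gives an exponentially small failure probability (`failureProb_le`).

Obliviousness. For fixed random choices the two plaintext access lists agree in times, files and
payload lengths. A distinguisher for the averaged patterns is at least as good for some fixed
choices; hardwiring these and both plaintext lists turns it into a non-adaptive left-or-right
adversary of polynomial size (`compIndist_accessPattern`). -/

def State.pendingBytes (σ : State p) : ℕ := (σ.buffer.map Pending.size).sum

/-- The block-ids in the current and in the shadow entry of file `f`. -/
def State.refSet (σ : State p) (f : ℕ) : Set (BlockId p) :=
  {γ | ∃ e, (σ.table f = some e ∨ σ.published f = some e) ∧ some γ ∈ e.locs}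

theorem State.refers_iff (σ : State p) (f : ℕ) (sel : BlockId p → Bool) :
    σ.refers f sel = true ↔ ∃ γ ∈ σ.refSet f, sel γ = true := by
  have key : ∀ o : Option (Entry p), ((((o.map Entry.locs).getD []).any
      fun o => (o.map sel).getD false) = true ↔
      ∃ γ, (∃ e, o = some e ∧ some γ ∈ e.locs) ∧ sel γ = true) := by
    intro o
    cases o with
    | none => simp
    | some e =>
      simp only [Option.map_some, Option.getD_some, List.any_eq_true]
      constructor
      · rintro ⟨x, hx, h⟩
        cases x with
        | none => simp at h
        | some γ => exact ⟨γ, ⟨e, rfl, hx⟩, by simpa using h⟩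
      · rintro ⟨γ, ⟨e', he, hγ⟩, h⟩
        cases he
        exact ⟨some γ, hγ, by simpa using h⟩
  simp only [State.refers, List.any_cons, List.any_nil, Bool.or_false, Bool.or_eq_true, key,
    State.refSet, Set.mem_ofPred_eq]
  constructor
  · rintro (⟨γ, ⟨e, he, h⟩, hs⟩ | ⟨γ, ⟨e, he, h⟩, hs⟩)
    · exact ⟨γ, ⟨e, .inl he, h⟩, hs⟩
    · exact ⟨γ, ⟨e, .inr he, h⟩, hs⟩
  · rintro ⟨γ, ⟨e, he | he, h⟩, hs⟩
    · exact .inl ⟨γ, ⟨e, he, h⟩, hs⟩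
    · exact .inr ⟨γ, ⟨e, he, h⟩, hs⟩

theorem fragsSize_le_of_sublist {xs ys : List (ℕ × List Byte)} (h : xs.Sublist ys) :
    fragsSize xs ≤ fragsSize ys :=
  (h.map _).sum_le_sum (by simp)

theorem fragsSize_append (xs ys : List (ℕ × List Byte)) :
    fragsSize (xs ++ ys) = fragsSize xs + fragsSize ys := by
  simp [fragsSize]

theorem used_ite_split (ys : List (ℕ × List Byte)) :
    (if ys.isEmpty then (Block.empty : Block p) else .split ys).used = fragsSize ys := by
  cases ys <;> simp [Block.used, fragsSize]

theorem Block.used_ite_le (c : Prop) [Decidable c] (b : Block p) :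
    (if c then b else .empty).used ≤ b.used := by
  split_ifs
  · exact le_rfl
  · exact Nat.zero_le _

theorem Block.used_ite_mono {c c' : Prop} [Decidable c] [Decidable c'] (h : c' → c)
    (b : Block p) :
    (if c' then b else .empty).used ≤ (if c then b else .empty).used := by
  by_cases hc' : c'
  · simp [hc', h hc']
  · simp [hc', Block.used]

theorem State.live_used_le (σ : State p) (β : BlockId p) :
    (σ.live β).used ≤ (σ.backend β).used := by
  unfold State.live
  cases h : σ.backend β with
  | empty => exact le_rfl
  | full f d => exact Block.used_ite_le _ _
  | leaf l es => exact Block.used_ite_le _ _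
  | split xs =>
    simp only [used_ite_split]
    exact fragsSize_le_of_sublist List.filter_sublist

/-- Losing references only makes data stale. The condition on references covers both blocks of the
pair, because a small fragment is live as soon as its file refers to either of them. -/
theorem State.live_used_mono {σ σ' : State p} {β : BlockId p}
    (hb : σ'.backend β = σ.backend β)
    (href : ∀ f, ∀ γ ∈ σ'.refSet f, γ.1 = β.1 → γ ∈ σ.refSet f)
    (hroot : ∀ l, σ'.root l = some β → σ.root l = some β) :
    (σ'.live β).used ≤ (σ.live β).used := by
  unfold State.live
  rw [hb]
  cases h : σ.backend β with
  | empty => exact le_rfl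
  | full f d =>
    refine Block.used_ite_mono ?_ _
    simp only [State.refers_iff]
    rintro ⟨γ, hγ, h⟩
    exact ⟨γ, href f γ hγ (by rw [of_decide_eq_true h]), h⟩
  | leaf l es => exact Block.used_ite_mono (hroot l) _
  | split xs =>
    simp only [used_ite_split]
    refine fragsSize_le_of_sublist (List.monotone_filter_right xs ?_)
    intro x hx
    rw [State.refers_iff] at hx ⊢
    obtain ⟨γ, hγ, h⟩ := hx
    exact ⟨γ, href _ γ hγ (of_decide_eq_true h), h⟩

/-! ## The operations between two syncs -/

/-- What an operation may do to the quantities that matter for the running time. -/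
structure OpStep (σ σ' : State p) : Prop where
  backend : σ'.backend = σ.backend
  root : σ'.root = σ.root
  cache : σ'.cache = σ.cache
  refSet : ∀ f, σ'.refSet f ⊆ σ.refSet f
  modified : σ.modified ≤ σ'.modified
  pending : σ'.pendingBytes + σ.modified ≤ σ.pendingBytes + σ'.modified

theorem OpStep.refl (σ : State p) : OpStep σ σ :=
  ⟨rfl, rfl, rfl, fun _ => subset_rfl, le_rfl, le_rfl⟩

theorem OpStep.trans {σ₁ σ₂ σ₃ : State p} (h : OpStep σ₁ σ₂) (h' : OpStep σ₂ σ₃) :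
    OpStep σ₁ σ₃ where
  backend := h'.backend.trans h.backend
  root := h'.root.trans h.root
  cache := h'.cache.trans h.cache
  refSet f := (h'.refSet f).trans (h.refSet f)
  modified := h.modified.trans h'.modified
  pending := by have := h.pending; have := h'.pending; omega

theorem sum_size_le_of_sublist {xs ys : List (Pending p)} (h : xs.Sublist ys) :
    (xs.map Pending.size).sum ≤ (ys.map Pending.size).sum :=
  (h.map _).sum_le_sum (by simp)

/-- Every block-id in the new entry is kept from the old one, so no reference appears. Filtering
only shrinks the buffer, and the fresh fragments are exactly what `modified` counts. -/
theorem State.put_opStep (σ : State p) (f size : ℕ) (new : List (Option (List Byte))) :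
    OpStep σ (σ.put f size new) where
  backend := rfl
  root := rfl
  cache := rfl
  refSet g γ := by
    rintro ⟨e, he | he, hγ⟩
    · by_cases hg : g = f
      · subst hg
        simp only [State.put, Function.update_self, Option.some.injEq] at he
        subst he
        simp only [List.mem_map] at hγ
        obtain ⟨i, -, hi⟩ := hγ
        split_ifs at hi
        cases ht : σ.table g with
        | none => simp [ht] at hi
        | some e =>
          refine ⟨e, .inl ht, ?_⟩
          simp only [ht, Option.map_some, Option.getD_some, List.getD_eq_getElem?_getD] at hi
          cases hl : e.locs[i]? with
          | none => simp [hl] at hi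
          | some o =>
            simp only [hl, Option.getD_some] at hi
            subst hi
            exact List.mem_of_getElem? hl
      · simp only [State.put, Function.update_of_ne hg] at he
        exact ⟨e, .inl he, hγ⟩
    · exact ⟨e, .inr he, hγ⟩
  modified := Nat.le_add_right _ _
  pending := by
    simp only [State.put, State.pendingBytes, List.map_append, List.sum_append]
    have h (keep : Pending p → Bool) := sum_size_le_of_sublist (p := p)
      (List.filter_sublist (l := σ.buffer) (p := keep))
    exact (Nat.add_le_add_right (Nat.add_le_add_right (h _) _) _).trans (by omega)

theorem State.putDir_opStep (fmt : Format p) (σ : State p) (dir : List (Name × ℕ)) :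
    OpStep σ (σ.putDir fmt dir) := by
  have h := σ.put_opStep 0 (fmt.dirBytes dir).length (chunks p (fmt.dirBytes dir))
  exact ⟨h.1, h.2, h.3, h.4, h.5, h.6⟩

/-- Clearing the current entry of a file, and possibly dropping pending fragments. -/
theorem OpStep.of_clear {σ σ' : State p} (f : ℕ) (e : Option (Entry p))
    (he : ∀ x, e = some x → x.locs = []) (hbackend : σ'.backend = σ.backend)
    (hroot : σ'.root = σ.root) (hcache : σ'.cache = σ.cache)
    (htable : σ'.table = Function.update σ.table f e)
    (hpublished : σ'.published = σ.published) (hmodified : σ'.modified = σ.modified)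
    (hbuffer : σ'.buffer.Sublist σ.buffer) : OpStep σ σ' where
  backend := hbackend
  root := hroot
  cache := hcache
  refSet g γ := by
    rintro ⟨x, hx | hx, hγ⟩
    · by_cases hg : g = f
      · subst hg
        rw [htable, Function.update_self] at hx
        simp [he x hx] at hγ
      · rw [htable, Function.update_of_ne hg] at hx
        exact ⟨x, .inl hx, hγ⟩
    · exact ⟨x, .inr (hpublished ▸ hx), hγ⟩
  modified := hmodified.ge
  pending := by
    have := sum_size_le_of_sublist hbuffer
    simp only [State.pendingBytes]
    omega

theorem State.apply_opStep (fmt : Format p) (σ : State p) (o : Op) :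
    OpStep σ (σ.apply fmt o) := by
  cases o with
  | create name =>
    simp only [State.apply]
    split
    · split_ifs
      · refine OpStep.trans ?_ (State.putDir_opStep _ _ _)
        exact OpStep.of_clear _ (some ⟨0, []⟩) (by rintro x ⟨⟩; rfl) rfl rfl rfl rfl rfl rfl
          (List.Sublist.refl _)
      · exact .refl σ
    · exact .refl σ
  | delete name =>
    simp only [State.apply]
    split
    · split_ifs
      · refine OpStep.trans ?_ (State.putDir_opStep _ _ _)
        exact OpStep.of_clear _ none (by simp) rfl rfl rfl rfl rfl rfl List.filter_sublist
      · exact .refl σ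
    · exact .refl σ
  | resize name size =>
    simp only [State.apply]
    split
    · split_ifs
      · exact State.put_opStep _ _ _ _
      · exact .refl σ
    · exact .refl σ
  | write name offset bytes =>
    simp only [State.apply]
    split
    · split_ifs
      · exact State.put_opStep _ _ _ _
      · exact .refl σ
    · exact .refl σ

theorem State.foldl_apply_opStep (fmt : Format p) (os : List Op) (σ : State p) :
    OpStep σ (os.foldl (State.apply fmt) σ) := by
  induction os generalizing σ with
  | nil => exact .refl σ
  | cons o os ih => exact (σ.apply_opStep fmt o).trans (ih _)

theorem OpStep.liveBytes_le {σ σ' : State p} (h : OpStep σ σ') :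
    σ'.liveBytes ≤ σ.liveBytes :=
  Finset.sum_le_sum fun β _ => State.live_used_mono (by rw [h.backend])
    (fun f _ hγ _ => h.refSet f hγ) (fun l hl => by rw [← h.root]; exact hl)

/-! ## Placing pending fragments -/

/-- Full blocks of the backend hold exactly one block of data. -/
def FullBlocks (bk : BlockId p → Block p) : Prop :=
  ∀ β f d, bk β = .full f d → d.length = p.blk

theorem Block.eq_empty_of_isEmpty {b : Block p} (h : b.isEmpty = true) : b = .empty := by
  cases b <;> simp_all [Block.isEmpty]

/-- Conservation of bytes: what leaves the buffer is added to exactly one chosen block. -/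
theorem place_eq_some {ids : List (BlockId p)} {bk : BlockId p → Block p} {x : Pending p}
    {β : BlockId p} {b : Block p} (h : place ids bk x = some (β, b)) :
    β ∈ ids ∧ b.used = (bk β).used + x.size ∧ b.isEmpty = false ∧
      (∀ f d, b = .full f d → d.length = p.blk) := by
  have empty_case : ∀ b' : Block p, b'.used = x.size → b'.isEmpty = false →
      (∀ f d, b' = .full f d → d.length = p.blk) →
      ((ids.find? fun β => (bk β).isEmpty).map fun β => (β, b')) = some (β, b) →
      β ∈ ids ∧ b.used = (bk β).used + x.size ∧ b.isEmpty = false ∧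
      (∀ f d, b = .full f d → d.length = p.blk) := by
    intro b' hb' hne hfull h
    simp only [Option.map_eq_some_iff, Prod.mk.injEq] at h
    obtain ⟨β', hβ', rfl, rfl⟩ := h
    have h1 := List.find?_some hβ'
    refine ⟨List.mem_of_find?_eq_some hβ', ?_, hne, hfull⟩
    rw [Block.eq_empty_of_isEmpty h1, hb']
    simp [Block.used]
  cases x with
  | leaf l es => exact empty_case (.leaf l es) rfl rfl (by simp) h
  | data f i d =>
    simp only [place] at h
    split_ifs at h with hd
    · exact empty_case (.full f d) rfl rfl (by rintro _ _ ⟨⟩; exact hd) h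
    · split at h
      · rename_i β' hβ'
        simp only [Option.some.injEq, Prod.mk.injEq] at h
        obtain ⟨rfl, rfl⟩ := h
        have h1 := List.find?_some hβ'
        refine ⟨List.mem_of_find?_eq_some hβ', ?_⟩
        cases hb : bk β' <;> simp [hb, Block.hasRoom] at h1
        simp [Block.addFrag, Block.used, Block.isEmpty, fragsSize, Pending.size]
      · exact empty_case (.split [(f, d)]) (by simp [Block.used, fragsSize, Pending.size]) rfl
          (by simp) h

/-- Every kind of fragment may fall back on an empty block, so failure means that there is none. A
leaf or full-size fragment brings `blk` bytes itself; for a small one, full blocks and leaves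
already hold `blk` bytes, and split blocks were rejected for lack of room. -/
theorem place_eq_none {ids : List (BlockId p)} {bk : BlockId p → Block p} {x : Pending p}
    (hfull : FullBlocks bk) (h : place ids bk x = none) {β : BlockId p} (hβ : β ∈ ids) :
    (bk β).isEmpty = false ∧ p.blk ≤ (bk β).used + x.size := by
  have aux : (ids.find? fun β => (bk β).isEmpty) = none → (bk β).isEmpty = false := by
    intro h
    simpa using List.find?_eq_none.1 h β hβ
  cases x with
  | leaf l es =>
    simp only [place, Option.map_eq_none_iff] at h
    exact ⟨aux h, by simp [Pending.size]⟩
  | data f i d =>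
    simp only [place] at h
    split_ifs at h with hd
    · simp only [Option.map_eq_none_iff] at h
      exact ⟨aux h, by simp [Pending.size, hd]⟩
    · split at h
      · simp at h
      · rename_i hroom
        simp only [Option.map_eq_none_iff] at h
        have hne := aux h
        refine ⟨hne, ?_⟩
        have hr := List.find?_eq_none.1 hroom β hβ
        cases hb : bk β with
        | empty => simp [hb, Block.isEmpty] at hne
        | full f d => simp [Block.used, hfull β f d hb]
        | leaf l es => simp [Block.used]
        | split xs =>
          simp only [hb, Block.hasRoom, decide_eq_true_eq, not_le] at hr
          simpa [Block.used, Pending.size] using hr.le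

/-- Effect of pushing a list of fragments `xs` from a state `σ` with an empty buffer, where the
chosen blocks are `U`. -/
structure PushInv (U : Finset (BlockId p)) (σ : State p) (xs : List (Pending p)) (σ' : State p) :
    Prop where
  full : FullBlocks σ'.backend
  outside : ∀ β ∉ U, σ'.backend β = σ.backend β
  refs : ∀ f, ∀ γ ∈ σ'.refSet f, γ ∉ U → γ ∈ σ.refSet f
  root : ∀ l, ∀ β ∉ U, σ'.root l = some β → σ.root l = some β
  published : σ'.published = σ.published
  cache : σ'.cache = σ.cache
  modified : σ'.modified = σ.modified
  buffer : σ'.buffer.Sublist xs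
  bytes : ∑ β ∈ U, (σ'.backend β).used + σ'.pendingBytes =
    ∑ β ∈ U, (σ.backend β).used + (xs.map Pending.size).sum
  used_le : ∀ β, (σ.backend β).used ≤ (σ'.backend β).used
  nonempty : ∀ y ∈ σ'.buffer, ∀ β ∈ U, (σ'.backend β).isEmpty = false
  noRoom : ∀ y ∈ σ'.buffer, ∀ β ∈ U, p.blk ≤ (σ'.backend β).used + y.size
  big : (∀ x ∈ xs, p.blk ≤ 2 * x.size) → ∀ β, (σ.backend β).isEmpty = true →
    (σ'.backend β).isEmpty = true ∨ p.blk ≤ 2 * (σ'.backend β).used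
  table : (∀ x ∈ xs, ∀ f, x.isFile f = false) → σ'.table = σ.table

theorem PushInv.refl (U : Finset (BlockId p)) {σ : State p} (hfull : FullBlocks σ.backend)
    (hbuffer : σ.buffer = []) : PushInv U σ [] σ where
  full := hfull
  outside _ _ := rfl
  refs _ _ h _ := h
  root _ _ _ h := h
  published := rfl
  cache := rfl
  modified := rfl
  buffer := by rw [hbuffer]
  bytes := by simp [State.pendingBytes, hbuffer]
  used_le _ := le_rfl
  nonempty := by simp [hbuffer]
  noRoom := by simp [hbuffer]
  big _ _ h := .inl h
  table _ := rfl

/-- `State.push` when a block is found. -/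
theorem State.push_of_some {ids : List (BlockId p)} {σ : State p} {x : Pending p}
    {β : BlockId p} {b : Block p} (h : place ids σ.backend x = some (β, b)) :
    (σ.push ids x).backend = Function.update σ.backend β b ∧
    (σ.push ids x).buffer = σ.buffer ∧ (σ.push ids x).published = σ.published ∧
    (σ.push ids x).cache = σ.cache ∧ (σ.push ids x).modified = σ.modified ∧
    (∀ f, ∀ γ ∈ (σ.push ids x).refSet f, γ = β ∨ γ ∈ σ.refSet f) ∧
    (∀ l γ, (σ.push ids x).root l = some γ → γ = β ∨ σ.root l = some γ) ∧
    ((∀ f, x.isFile f = false) → (σ.push ids x).table = σ.table) := by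
  cases x with
  | data f i d =>
    simp only [State.push, h]
    refine ⟨trivial, trivial, trivial, trivial, trivial, ?_, fun l γ h => .inr h, ?_⟩
    · rintro g γ ⟨e, he | he, hγ⟩
      · by_cases hg : g = f
        · subst hg
          simp only [Function.update_self, Option.map_eq_some_iff] at he
          obtain ⟨e', he', rfl⟩ := he
          rcases List.mem_or_eq_of_mem_set hγ with h | h
          · exact .inr ⟨e', .inl he', h⟩
          · exact .inl (by simpa using h)
        · simp only [Function.update_of_ne hg] at he
          exact .inr ⟨e, .inl he, hγ⟩
      · exact .inr ⟨e, .inr he, hγ⟩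
    · intro h
      simpa [Pending.isFile] using h f
  | leaf l es =>
    simp only [State.push, h]
    refine ⟨trivial, trivial, trivial, trivial, trivial, fun f γ h => .inr h, ?_,
      fun _ => trivial⟩
    intro l' γ hγ
    by_cases hl : l' = l
    · subst hl
      simp only [Function.update_self, Option.some.injEq] at hγ
      exact .inl hγ.symm
    · simp only [Function.update_of_ne hl] at hγ
      exact .inr hγ

/-- Pushing only adds bytes to chosen blocks, so a fragment that found no room earlier would still
find none at the end; this is why `nonempty` and `noRoom` survive later pushes. -/
theorem PushInv.push {ids : List (BlockId p)} {U : Finset (BlockId p)}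
    (hU : ∀ β, β ∈ U ↔ β ∈ ids) {σ σ' : State p} {xs : List (Pending p)}
    (h : PushInv U σ xs σ') (x : Pending p) : PushInv U σ (xs ++ [x]) (σ'.push ids x) := by
  cases hp : place ids σ'.backend x with
  | none =>
    have hpush : σ'.push ids x = { σ' with buffer := σ'.buffer ++ [x] } := by
      simp only [State.push, hp]
    rw [hpush]
    exact
    { full := h.full
      outside := h.outside
      refs := h.refs
      root := h.root
      published := h.published
      cache := h.cache
      modified := h.modified
      buffer := h.buffer.append (List.Sublist.refl _)
      bytes := by
        have := h.bytes
        simp only [State.pendingBytes, List.map_append, List.sum_append] at this ⊢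
        omega
      used_le := h.used_le
      nonempty := fun y hy β hβ => (place_eq_none h.full hp ((hU β).1 hβ)).1
      noRoom := by
        intro y hy β hβ
        rcases List.mem_append.1 hy with hy | hy
        · exact h.noRoom y hy β hβ
        · rw [List.mem_singleton.1 hy]
          exact (place_eq_none h.full hp ((hU β).1 hβ)).2
      big := fun hb => h.big fun x hx => hb x (by simp [hx])
      table := fun ht => h.table fun x hx => ht x (by simp [hx]) }
  | some r =>
    obtain ⟨β₀, b⟩ := r
    obtain ⟨hmem, hused, hne, hfull⟩ := place_eq_some hp
    obtain ⟨h1, h2, h3, h4, h5, h6, h7, h8⟩ := State.push_of_some hp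
    have hβ₀ := (hU β₀).2 hmem
    have used_mono : ∀ β, (σ'.backend β).used ≤ (Function.update σ'.backend β₀ b β).used := by
      intro β
      by_cases hβ : β = β₀
      · subst hβ
        rw [Function.update_self]
        omega
      · rw [Function.update_of_ne hβ]
    exact
    { full := by
        intro β f d hd
        rw [h1] at hd
        by_cases hβ : β = β₀
        · subst hβ
          rw [Function.update_self] at hd
          exact hfull f d hd
        · rw [Function.update_of_ne hβ] at hd
          exact h.full β f d hd
      outside := by
        intro β hβ
        rw [h1, Function.update_of_ne (by rintro rfl; exact hβ hβ₀)]
        exact h.outside β hβ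
      refs := by
        intro f γ hγ hU'
        rcases h6 f γ hγ with rfl | hγ
        · exact absurd hβ₀ hU'
        · exact h.refs f γ hγ hU'
      root := by
        intro l β hβ hl
        rcases h7 l β hl with rfl | hl
        · exact absurd hβ₀ hβ
        · exact h.root l β hβ hl
      published := h3.trans h.published
      cache := h4.trans h.cache
      modified := h5.trans h.modified
      buffer := by
        rw [h2]
        exact h.buffer.trans (List.sublist_append_left _ _)
      bytes := by
        have := h.bytes
        have e1 := Finset.add_sum_erase U (fun β => (σ'.backend β).used) hβ₀
        have e2 := Finset.add_sum_erase U
          (fun β => (Function.update σ'.backend β₀ b β).used) hβ₀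
        have e3 : ∑ β ∈ U.erase β₀, (Function.update σ'.backend β₀ b β).used =
            ∑ β ∈ U.erase β₀, (σ'.backend β).used :=
          Finset.sum_congr rfl fun β hβ => by
            rw [Function.update_of_ne (Finset.ne_of_mem_erase hβ)]
        simp only [Function.update_self] at e1 e2
        simp only [State.pendingBytes, List.map_append, List.sum_append, h1, h2, List.map_cons,
          List.map_nil, List.sum_singleton] at this ⊢
        omega
      used_le := fun β => by
        rw [h1]
        exact (h.used_le β).trans (used_mono β)
      nonempty := by
        intro y hy β hβ
        rw [h2] at hy
        rw [h1]
        by_cases hb : β = β₀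
        · subst hb
          rwa [Function.update_self]
        · rw [Function.update_of_ne hb]
          exact h.nonempty y hy β hβ
      noRoom := by
        intro y hy β hβ
        rw [h2] at hy
        rw [h1]
        have := h.noRoom y hy β hβ
        have := used_mono β
        omega
      big := by
        intro hb β hβ
        rw [h1]
        by_cases hb' : β = β₀
        · subst hb'
          have := hb x (by simp)
          rw [Function.update_self]
          right
          omega
        · rw [Function.update_of_ne hb']
          exact h.big (fun x hx => hb x (by simp [hx])) β hβ
      table := by
        intro ht
        rw [h8 (ht x (by simp))]
        exact h.table fun x hx => ht x (by simp [hx]) }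

theorem PushInv.foldl {ids : List (BlockId p)} {U : Finset (BlockId p)}
    (hU : ∀ β, β ∈ U ↔ β ∈ ids) {σ σ' : State p} {xs : List (Pending p)}
    (h : PushInv U σ xs σ') (ys : List (Pending p)) :
    PushInv U σ (xs ++ ys) (ys.foldl (State.push ids) σ') := by
  induction ys generalizing xs σ' with
  | nil => simpa using h
  | cons y ys ih =>
    have := ih (h.push hU y)
    simpa using this

/-! ## Cache eviction -/

/-- The eviction loop stops. -/
def State.Quiet (σ : State p) : Prop := σ.cache.card ≤ p.cacheCap ∨ p.n = 0

/-- What evictions may do. -/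
structure EvictStep (σ σ' : State p) : Prop where
  backend : σ'.backend = σ.backend
  root : σ'.root = σ.root
  table : σ'.table = σ.table
  published : σ'.published = σ.published
  cache : σ'.cache ⊆ σ.cache
  modified : σ.modified ≤ σ'.modified
  pending : σ'.pendingBytes + σ.modified ≤ σ.pendingBytes + σ'.modified
  buffer : ∀ x ∈ σ'.buffer, x ∈ σ.buffer ∨ ∃ l es, x = .leaf l es
  buffer_eq_nil : σ'.buffer = [] → σ.buffer = []

theorem EvictStep.refl (σ : State p) : EvictStep σ σ :=
  ⟨rfl, rfl, rfl, rfl, subset_rfl, le_rfl, le_rfl, fun _ h => .inl h, id⟩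

theorem EvictStep.trans {σ₁ σ₂ σ₃ : State p} (h : EvictStep σ₁ σ₂) (h' : EvictStep σ₂ σ₃) :
    EvictStep σ₁ σ₃ where
  backend := h'.backend.trans h.backend
  root := h'.root.trans h.root
  table := h'.table.trans h.table
  published := h'.published.trans h.published
  cache := h'.cache.trans h.cache
  modified := h.modified.trans h'.modified
  pending := by have := h.pending; have := h'.pending; omega
  buffer x hx := (h'.buffer x hx).elim (h.buffer x) .inr
  buffer_eq_nil hx := h.buffer_eq_nil (h'.buffer_eq_nil hx)

theorem State.evictOnce_evictStep (σ : State p) : EvictStep σ σ.evictOnce := by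
  unfold State.evictOnce
  split_ifs
  · exact .refl σ
  · split
    · exact .refl σ
    · refine ⟨rfl, rfl, rfl, rfl, Finset.filter_subset _ _, Nat.le_add_right _ _, ?_, ?_, ?_⟩
      · simp only [State.pendingBytes, List.map_append, List.sum_append, List.map_cons,
          List.map_nil, List.sum_singleton, Pending.size]
        have h (keep : Pending p → Bool) := sum_size_le_of_sublist (p := p)
          (List.filter_sublist (l := σ.buffer) (p := keep))
        exact (Nat.add_le_add_right (Nat.add_le_add_right (h _) _) _).trans (by omega)
      · intro x hx
        rcases List.mem_append.1 hx with hx | hx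
        · exact .inl (List.mem_of_mem_filter hx)
        · exact .inr ⟨_, _, List.mem_singleton.1 hx⟩
      · intro h
        simp at h

theorem State.Quiet.evictOnce_eq {σ : State p} (h : σ.Quiet) : σ.evictOnce = σ := by
  unfold State.evictOnce
  split_ifs with hc
  · rfl
  · rcases h with h | h
    · exact absurd h hc
    · simp [h]

/-- The leaf of any cached file competes in the maximum, so the most common leaf loses at least one
cached entry. The bound on the cache and `n ≠ 0` ensure that this leaf is among the candidates. -/
theorem State.card_evictOnce_lt {σ : State p} (hq : ¬ σ.Quiet)
    (hcache : σ.cache ⊆ insert 0 (Finset.range p.n)) :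
    σ.evictOnce.cache.card < σ.cache.card := by
  simp only [State.Quiet, not_or] at hq
  obtain ⟨hcard, hn⟩ := hq
  unfold State.evictOnce
  rw [if_neg hcard]
  split
  · rename_i h
    simp [List.argmax_eq_none, hn] at h
  · rename_i l hl
    obtain ⟨f, hf⟩ : σ.cache.Nonempty := Finset.card_pos.1 (by omega)
    have hfn : f / p.leafCap ∈ List.range p.n := by
      have : f < p.n := by
        rcases Finset.mem_insert.1 (hcache hf) with h | h
        · omega
        · exact Finset.mem_range.1 h
      exact List.mem_range.2 ((Nat.div_le_self _ _).trans_lt this)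
    have hmax := List.le_of_mem_argmax hfn (Option.mem_def.2 hl)
    have hpos : 0 < (σ.cache.filter fun g => g / p.leafCap = l).card := by
      refine lt_of_lt_of_le ?_ hmax
      exact Finset.card_pos.2 ⟨f, Finset.mem_filter.2 ⟨hf, rfl⟩⟩
    have := Finset.card_filter_add_card_filter_not (s := σ.cache)
      (fun g => g / p.leafCap = l)
    simp only [ne_eq] at this ⊢
    omega

theorem State.iterate_evictOnce_evictStep (m : ℕ) (σ : State p) :
    EvictStep σ (State.evictOnce^[m] σ) := by
  induction m generalizing σ with
  | zero => exact .refl σ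
  | succ m ih => exact σ.evictOnce_evictStep.trans (ih _)

theorem State.Quiet.evict_eq {σ : State p} (h : σ.Quiet) : σ.evict = σ :=
  Function.iterate_fixed h.evictOnce_eq _

theorem State.quiet_iterate_evictOnce (m : ℕ) (σ : State p) (hm : σ.cache.card ≤ m)
    (hcache : σ.cache ⊆ insert 0 (Finset.range p.n)) :
    (State.evictOnce^[m] σ).Quiet := by
  induction m generalizing σ with
  | zero => exact .inl (hm.trans (Nat.zero_le _))
  | succ m ih =>
    by_cases hq : σ.Quiet
    · rwa [Function.iterate_fixed hq.evictOnce_eq]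
    · have := State.card_evictOnce_lt hq hcache
      exact ih _ (by omega) (σ.evictOnce_evictStep.cache.trans hcache)

theorem State.evict_evictStep (σ : State p) : EvictStep σ σ.evict :=
  State.iterate_evictOnce_evictStep _ σ

/-! ## Repacking -/

theorem State.repack_used (σ : State p) (q : Fin p.N) :
    (σ.repack q).1.used + (σ.repack q).2.used =
      (σ.live (q, false)).used + (σ.live (q, true)).used := by
  unfold State.repack
  split
  · rename_i xs ys hx hy
    rw [hx, hy]
    split_ifs
    · simp [Block.used, fragsSize_append]
    · rfl
  · rfl

theorem State.live_eq_full {σ : State p} {β : BlockId p} {f : ℕ} {d : List Byte}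
    (h : σ.live β = .full f d) : σ.backend β = .full f d := by
  unfold State.live at h
  cases hb : σ.backend β <;> simp only [hb] at h
  · simp at h
  · split_ifs at h
    exact h
  · split_ifs at h
  · split_ifs at h

theorem State.repack_fst_eq_full {σ : State p} {q : Fin p.N} {f : ℕ} {d : List Byte}
    (h : (σ.repack q).1 = .full f d) : σ.backend (q, false) = .full f d := by
  unfold State.repack at h
  split at h
  · split_ifs at h
  · exact State.live_eq_full h

theorem State.repack_snd_eq_full {σ : State p} {q : Fin p.N} {f : ℕ} {d : List Byte}
    (h : (σ.repack q).2 = .full f d) : σ.backend (q, true) = .full f d := by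
  unfold State.repack at h
  split at h
  · split_ifs at h
  · exact State.live_eq_full h

/-- The pairs that have an empty block after removal of stale data and repacking. -/
def State.goodPairs (σ : State p) : Finset (Fin p.N) :=
  Finset.univ.filter fun q => (σ.repack q).1.isEmpty = true ∨ (σ.repack q).2.isEmpty = true

theorem Block.blk_le_used_or {b : Block p} (hfull : ∀ f d, b = .full f d → d.length = p.blk) :
    b.isEmpty = true ∨ p.blk ≤ b.used ∨ ∃ xs, b = .split xs := by
  cases b with
  | empty => exact .inl rfl
  | full f d => exact .inr (.inl (hfull f d rfl).ge)
  | leaf l es => exact .inr (.inl le_rfl)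
  | split xs => exact .inr (.inr ⟨xs, rfl⟩)

/-- Both blocks are nonempty after repacking. If one is full or a leaf, it alone has `blk` bytes; if
both are split, they were not combined, so together they exceed `blk`. -/
theorem State.blk_le_of_notMem_goodPairs {σ : State p} (hfull : FullBlocks σ.backend)
    {q : Fin p.N} (hq : q ∉ σ.goodPairs) :
    p.blk ≤ (σ.live (q, false)).used + (σ.live (q, true)).used := by
  simp only [State.goodPairs, Finset.mem_filter, Finset.mem_univ, true_and, not_or] at hq
  have h1 := Block.blk_le_used_or (b := (σ.repack q).1)
    fun f d h => hfull _ f d (State.repack_fst_eq_full h)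
  have h2 := Block.blk_le_used_or (b := (σ.repack q).2)
    fun f d h => hfull _ f d (State.repack_snd_eq_full h)
  have hsum := σ.repack_used q
  rcases h1 with h1 | h1 | ⟨xs, h1⟩
  · exact absurd h1 hq.1
  · omega
  · rcases h2 with h2 | h2 | ⟨ys, h2⟩
    · exact absurd h2 hq.2
    · omega
    · rw [← hsum, h1, h2]
      unfold State.repack at h1 h2
      split at h1
      · rename_i xs' ys' hx hy
        rw [hx, hy] at h2
        dsimp only at h2
        by_cases hc : fragsSize xs' + fragsSize ys' ≤ p.blk
        · simp [hc] at h2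
        · simp only [hc, if_false, Block.split.injEq] at h1 h2
          subst h1 h2
          simp only [Block.used]
          omega
      · rename_i hno
        split at h2
        · rename_i hx hy
          exact absurd hy (hno _ _ hx)
        · exact absurd h2 (hno _ _ h1)

theorem State.liveBytes_eq (σ : State p) :
    σ.liveBytes = ∑ q, ((σ.live (q, false)).used + (σ.live (q, true)).used) := by
  simp only [State.liveBytes, Fintype.sum_prod_type, Fintype.sum_bool]
  exact Finset.sum_congr rfl fun q _ => add_comm _ _

theorem State.le_two_mul_card_goodPairs {σ : State p} (hfull : FullBlocks σ.backend)
    (hlive : 2 * σ.liveBytes ≤ p.N * p.blk) : p.N ≤ 2 * σ.goodPairs.card := by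
  have h1 : (σ.goodPairsᶜ).card * p.blk ≤ σ.liveBytes := by
    rw [State.liveBytes_eq, ← smul_eq_mul, ← Finset.sum_const]
    exact (Finset.sum_le_sum fun q hq => State.blk_le_of_notMem_goodPairs hfull
      (Finset.mem_compl.1 hq)).trans (Finset.sum_le_univ_sum_of_nonneg fun _ => Nat.zero_le _)
  have h2 : (2 * (σ.goodPairsᶜ).card) * p.blk ≤ p.N * p.blk := by nlinarith
  have h3 := Nat.le_of_mul_le_mul_right h2 p.blk_pos
  have h4 := Finset.card_add_card_compl σ.goodPairs
  rw [Fintype.card_fin] at h4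
  omega

/-! ## The stages of a sync -/

def chosenIds (S : Choice p) : List (BlockId p) :=
  (S.1.sort (· ≤ ·)).flatMap fun q => [(q, false), (q, true)]

def chosenBlocks (S : Choice p) : Finset (BlockId p) := S.1 ×ˢ Finset.univ

theorem mem_chosenBlocks {S : Choice p} {β : BlockId p} : β ∈ chosenBlocks S ↔ β.1 ∈ S.1 := by
  simp [chosenBlocks]

theorem mem_chosenBlocks_iff_mem_chosenIds (S : Choice p) (β : BlockId p) :
    β ∈ chosenBlocks S ↔ β ∈ chosenIds S := by
  obtain ⟨q, b⟩ := β
  cases b <;> simp [chosenBlocks, chosenIds]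

/-- The state after removal of stale data and repacking, with an empty buffer. -/
def State.cleaned (σ : State p) (S : Choice p) : State p :=
  { σ with
    buffer := []
    backend := fun β =>
      if β.1 ∈ S.1 then (if β.2 then (σ.repack β.1).2 else (σ.repack β.1).1)
      else σ.backend β }

/-- The buffer in the order in which it is processed. -/
def State.queue (σ : State p) : List (Pending p) :=
  (σ.buffer.filter fun x => x.isFile 0) ++ (σ.buffer.filter fun x => !x.isFile 0)

/-- The state after all pending fragments have been tried. -/
def State.pushed (σ : State p) (S : Choice p) : State p :=
  σ.queue.foldl (State.push (chosenIds S)) (σ.cleaned S)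

theorem State.sync_eq (σ : State p) (S : Choice p) :
    σ.sync S = (σ.pushed S).publish.evict := rfl

theorem State.queue_perm (σ : State p) : σ.queue.Perm σ.buffer :=
  List.filter_append_perm _ _

theorem State.cleaned_fullBlocks {σ : State p} (hfull : FullBlocks σ.backend) (S : Choice p) :
    FullBlocks (σ.cleaned S).backend := by
  rintro ⟨q, b⟩ f d h
  simp only [State.cleaned] at h
  split_ifs at h with h1 h2
  · exact hfull _ f d (State.repack_snd_eq_full h)
  · exact hfull _ f d (State.repack_fst_eq_full h)
  · exact hfull _ f d h

theorem State.pushed_inv {σ : State p} (hfull : FullBlocks σ.backend) (S : Choice p) :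
    PushInv (chosenBlocks S) (σ.cleaned S) σ.queue (σ.pushed S) := by
  have := (PushInv.refl (chosenBlocks S) (State.cleaned_fullBlocks hfull S) rfl).foldl
    (mem_chosenBlocks_iff_mem_chosenIds S) σ.queue
  rwa [List.nil_append] at this

theorem State.cleaned_used (σ : State p) (S : Choice p) :
    ∑ β ∈ chosenBlocks S, ((σ.cleaned S).backend β).used =
      ∑ β ∈ chosenBlocks S, (σ.live β).used := by
  simp only [chosenBlocks, Finset.sum_product, Fintype.sum_bool]
  refine Finset.sum_congr rfl fun q hq => ?_
  have := σ.repack_used q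
  simp only [State.cleaned, hq, if_true]
  simpa [add_comm] using this

theorem State.publish_refSet (σ : State p) (f : ℕ) : σ.publish.refSet f ⊆ σ.refSet f := by
  rintro γ ⟨e, he | he, hγ⟩
  · exact ⟨e, .inl he, hγ⟩
  · simp only [State.publish] at he
    split_ifs at he
    · exact ⟨e, .inr he, hγ⟩
    · exact ⟨e, .inl he, hγ⟩

theorem State.queue_size (σ : State p) : (σ.queue.map Pending.size).sum = σ.pendingBytes :=
  (σ.queue_perm.map _).sum_eq

theorem State.sync_fullBlocks {σ : State p} (hfull : FullBlocks σ.backend) (S : Choice p) :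
    FullBlocks (σ.sync S).backend := by
  rw [State.sync_eq, (State.evict_evictStep _).backend]
  exact (State.pushed_inv hfull S).full

theorem State.sync_cache {σ : State p} (hfull : FullBlocks σ.backend) (S : Choice p)
    (hcache : σ.cache ⊆ insert 0 (Finset.range p.n)) :
    (σ.pushed S).publish.cache ⊆ insert 0 (Finset.range p.n) := by
  simp only [State.publish, (State.pushed_inv hfull S).cache]
  exact Finset.union_subset hcache
    ((Finset.filter_subset _ _).trans (Finset.subset_insert _ _))

theorem State.sync_modified {σ : State p} (hfull : FullBlocks σ.backend) (S : Choice p) :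
    σ.modified ≤ (σ.sync S).modified := by
  have h1 := (State.pushed_inv hfull S).modified
  have h2 := (State.evict_evictStep (σ.pushed S).publish).modified
  rw [State.sync_eq]
  exact h1.ge.trans h2

theorem State.sync_pending {σ : State p} (hfull : FullBlocks σ.backend) (S : Choice p) :
    (σ.sync S).pendingBytes + σ.modified ≤
      (σ.pushed S).pendingBytes + (σ.sync S).modified := by
  have h2 := (State.evict_evictStep (σ.pushed S).publish).pending
  rw [State.sync_eq]
  rw [show σ.modified = (σ.pushed S).publish.modified from
    (State.pushed_inv hfull S).modified.symm]
  exact h2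

/-- In the chosen blocks, cleaning keeps exactly the live bytes and pushing moves bytes out of the
buffer. Elsewhere nothing becomes live, because new references point to chosen blocks only and
publishing merely copies references. Only evictions add bytes, and `modified` counts them. -/
theorem State.sync_liveBytes {σ : State p} (hfull : FullBlocks σ.backend) (S : Choice p) :
    (σ.sync S).liveBytes + (σ.sync S).pendingBytes + σ.modified ≤
      σ.liveBytes + σ.pendingBytes + (σ.sync S).modified := by
  have hinv := State.pushed_inv hfull S
  have hev := State.evict_evictStep (σ.pushed S).publish
  have hbytes := hinv.bytes
  rw [σ.queue_size, State.cleaned_used] at hbytes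
  have hp := State.sync_pending hfull S
  have hrefs : ∀ f, (σ.sync S).refSet f ⊆ (σ.pushed S).refSet f := by
    intro f
    refine subset_trans ?_ (State.publish_refSet (σ.pushed S) f)
    rintro γ ⟨e, he, hγ⟩
    rw [State.sync_eq, hev.table, hev.published] at he
    exact ⟨e, he, hγ⟩
  have hlive : (σ.sync S).liveBytes ≤
      ∑ β ∈ chosenBlocks S, ((σ.pushed S).backend β).used +
        ∑ β ∈ (chosenBlocks S)ᶜ, (σ.live β).used := by
    unfold State.liveBytes
    rw [← Finset.sum_add_sum_compl (chosenBlocks S)]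
    refine add_le_add (Finset.sum_le_sum fun β _ => ?_) (Finset.sum_le_sum fun β hβ => ?_)
    · refine (State.live_used_le _ β).trans_eq ?_
      rw [State.sync_eq, hev.backend]
      rfl
    · have hβ' : β.1 ∉ S.1 := fun h => Finset.mem_compl.1 hβ (mem_chosenBlocks.2 h)
      refine State.live_used_mono ?_ ?_ ?_
      · rw [State.sync_eq, hev.backend]
        refine (hinv.outside β (Finset.mem_compl.1 hβ)).trans ?_
        simp [State.cleaned, hβ']
      · intro f γ hγ hγβ
        exact hinv.refs f γ (hrefs f hγ) (by rw [mem_chosenBlocks, hγβ]; exact hβ')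
      · intro l hl
        rw [State.sync_eq, hev.root] at hl
        exact hinv.root l β (Finset.mem_compl.1 hβ) hl
  have hsplit : ∑ β ∈ chosenBlocks S, (σ.live β).used +
      ∑ β ∈ (chosenBlocks S)ᶜ, (σ.live β).used = σ.liveBytes :=
    Finset.sum_add_sum_compl _ _
  omega

/-! ## Progress of a sync -/

/-- All pending fragments have at least half the size of a block. -/
def State.Big (σ : State p) : Prop := ∀ x ∈ σ.buffer, p.blk ≤ 2 * x.size

/-- Only leaf nodes are pending, the published filetable is up to date, and there will be no
further evictions. -/
def State.Settled (σ : State p) : Prop :=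
  (∀ x ∈ σ.buffer, ∀ f, x.isFile f = false) ∧ σ.published = σ.table ∧ σ.Quiet

open Classical in
/-- The number of poor syncs that may still come: one that leaves only large fragments behind,
and one that clears the buffer before evictions fill it again. -/
noncomputable def State.debt (σ : State p) : ℕ :=
  (if σ.Big then 0 else 1) + (if σ.Settled then 0 else 1)

theorem State.debt_le_two (σ : State p) : σ.debt ≤ 2 := by
  unfold State.debt
  split_ifs <;> omega

theorem State.debt_le_of {σ σ' : State p} (hbig : σ.Big → σ'.Big)
    (hset : σ.Settled → σ'.Settled) : σ'.debt ≤ σ.debt := by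
  unfold State.debt
  by_cases h1 : σ.Big <;> by_cases h2 : σ.Settled <;> by_cases h3 : σ'.Big <;>
    by_cases h4 : σ'.Settled <;> simp_all

theorem State.debt_lt_of {σ σ' : State p} (hbig : σ.Big → σ'.Big)
    (hset : σ.Settled → σ'.Settled)
    (h : (¬ σ.Big ∧ σ'.Big) ∨ (¬ σ.Settled ∧ σ'.Settled)) : σ'.debt + 1 ≤ σ.debt := by
  unfold State.debt
  by_cases h1 : σ.Big <;> by_cases h2 : σ.Settled <;> by_cases h3 : σ'.Big <;>
    by_cases h4 : σ'.Settled <;> simp_all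

theorem State.Big.of_subset {σ σ' : State p} (h : ∀ x ∈ σ.buffer, p.blk ≤ 2 * x.size)
    (hb : ∀ x ∈ σ'.buffer, x ∈ σ.buffer ∨ ∃ l es, x = .leaf l es) : σ'.Big := by
  intro x hx
  rcases hb x hx with hx | ⟨l, es, rfl⟩
  · exact h x hx
  · simp only [Pending.size]
    omega

theorem State.mem_pushed_buffer {σ : State p} (hfull : FullBlocks σ.backend) {S : Choice p}
    {x : Pending p} (hx : x ∈ (σ.pushed S).buffer) : x ∈ σ.buffer :=
  σ.queue_perm.subset ((State.pushed_inv hfull S).buffer.subset hx)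

theorem State.mem_sync_buffer (σ : State p) {S : Choice p}
    {x : Pending p} (hx : x ∈ (σ.sync S).buffer) :
    x ∈ (σ.pushed S).buffer ∨ ∃ l es, x = .leaf l es :=
  (State.evict_evictStep (σ.pushed S).publish).buffer x hx

theorem State.Big.sync {σ : State p} (h : σ.Big) (hfull : FullBlocks σ.backend)
    (S : Choice p) : (σ.sync S).Big :=
  State.Big.of_subset h fun _ hx => (σ.mem_sync_buffer hx).imp_left
    (State.mem_pushed_buffer hfull)

/-- Pushing leaf nodes leaves the current table alone, so publishing changes no entry, the cache
does not grow and no eviction is triggered. -/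
theorem State.Settled.sync_and_buffer_eq {σ : State p} (h : σ.Settled)
    (hfull : FullBlocks σ.backend) (S : Choice p) :
    (σ.sync S).Settled ∧ (σ.sync S).buffer = (σ.pushed S).buffer := by
  obtain ⟨h1, h2, h3⟩ := h
  have hinv := State.pushed_inv hfull S
  have htable : (σ.pushed S).table = σ.table :=
    hinv.table fun x hx => h1 x (σ.queue_perm.subset hx)
  have hpub : (σ.pushed S).publish.published = σ.published := by
    funext f
    simp only [State.publish, hinv.published, htable, ← h2]
    exact ite_self _
  have hcache : (σ.pushed S).publish.cache = σ.cache := by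
    have : ∀ f, (if (σ.pushed S).buffer.any (Pending.isFile f) then (σ.pushed S).published f
        else (σ.pushed S).table f) = (σ.pushed S).published f := by
      intro f
      exact (congrFun hpub f).trans (congrFun hinv.published f).symm
    simp only [State.publish, this, hinv.cache]
    simp [State.cleaned]
  have hq : (σ.pushed S).publish.Quiet := by
    simpa only [State.Quiet, hcache] using h3
  rw [State.sync_eq, hq.evict_eq]
  refine ⟨⟨fun x hx => h1 x (State.mem_pushed_buffer hfull hx), ?_, hq⟩, rfl⟩
  rw [hpub, h2]
  exact htable.symm

theorem State.settled_sync_of_pushed {σ : State p} (hfull : FullBlocks σ.backend) {S : Choice p}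
    (hcache : σ.cache ⊆ insert 0 (Finset.range p.n)) (h : (σ.pushed S).buffer = []) :
    (σ.sync S).Settled := by
  have hev := State.evict_evictStep (σ.pushed S).publish
  refine ⟨?_, ?_, ?_⟩
  · intro x hx f
    rcases σ.mem_sync_buffer hx with hx | ⟨l, es, rfl⟩
    · simp [h] at hx
    · rfl
  · rw [State.sync_eq, hev.published, hev.table]
    funext f
    simp [State.publish, h]
  · exact State.quiet_iterate_evictOnce _ _ le_rfl (State.sync_cache hfull S hcache)

/-- The chosen blocks that are empty before the pending fragments are placed. -/
def State.emptyBlocks (σ : State p) (S : Choice p) : Finset (BlockId p) :=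
  (chosenBlocks S).filter fun β => ((σ.cleaned S).backend β).isEmpty = true

/-- Each chosen good pair contributes an empty block, and distinct pairs have distinct blocks. -/
theorem State.card_le_card_emptyBlocks (σ : State p) (S : Choice p) :
    (S.1 ∩ σ.goodPairs).card ≤ (σ.emptyBlocks S).card := by
  refine (Finset.card_le_card ?_).trans (Finset.card_image_le (f := Prod.fst))
  intro q hq
  obtain ⟨hS, hg⟩ := Finset.mem_inter.1 hq
  simp only [State.goodPairs, Finset.mem_filter, Finset.mem_univ, true_and] at hg
  simp only [Finset.mem_image, State.emptyBlocks, Finset.mem_filter, mem_chosenBlocks]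
  rcases hg with hg | hg
  · exact ⟨(q, false), ⟨hS, by simpa [State.cleaned, hS] using hg⟩, rfl⟩
  · exact ⟨(q, true), ⟨hS, by simpa [State.cleaned, hS] using hg⟩, rfl⟩

/-- By conservation of bytes, whatever fills the initially empty blocks has left the buffer, since
no other chosen block loses data. -/
theorem State.card_mul_blk_le {σ : State p} (hfull : FullBlocks σ.backend) (S : Choice p)
    (h : ∀ β ∈ σ.emptyBlocks S, p.blk ≤ 2 * ((σ.pushed S).backend β).used) :
    (S.1 ∩ σ.goodPairs).card * p.blk + 2 * (σ.pushed S).pendingBytes ≤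
      2 * σ.pendingBytes := by
  have hinv := State.pushed_inv hfull S
  have hbytes := hinv.bytes
  rw [σ.queue_size] at hbytes
  have h1 : (S.1 ∩ σ.goodPairs).card * p.blk ≤ (σ.emptyBlocks S).card * p.blk :=
    Nat.mul_le_mul_right _ (σ.card_le_card_emptyBlocks S)
  have h2 : (σ.emptyBlocks S).card * p.blk ≤
      2 * ∑ β ∈ σ.emptyBlocks S, ((σ.pushed S).backend β).used := by
    rw [← smul_eq_mul, ← Finset.sum_const, Finset.mul_sum]
    exact Finset.sum_le_sum h
  have h3 := Finset.sum_filter_add_sum_filter_not (chosenBlocks S)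
    (fun β => ((σ.cleaned S).backend β).isEmpty = true)
    (fun β => ((σ.pushed S).backend β).used)
  have h4 := Finset.sum_filter_add_sum_filter_not (chosenBlocks S)
    (fun β => ((σ.cleaned S).backend β).isEmpty = true)
    (fun β => ((σ.cleaned S).backend β).used)
  have h5 : ∑ β ∈ (chosenBlocks S).filter
      (fun β => ((σ.cleaned S).backend β).isEmpty = true),
      ((σ.cleaned S).backend β).used = 0 :=
    Finset.sum_eq_zero fun β hβ => by
      rw [Block.eq_empty_of_isEmpty (Finset.mem_filter.1 hβ).2]
      rfl
  have h6 : ∑ β ∈ (chosenBlocks S).filter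
      (fun β => ¬ ((σ.cleaned S).backend β).isEmpty = true),
      ((σ.cleaned S).backend β).used ≤ ∑ β ∈ (chosenBlocks S).filter
      (fun β => ¬ ((σ.cleaned S).backend β).isEmpty = true),
      ((σ.pushed S).backend β).used :=
    Finset.sum_le_sum fun β _ => hinv.used_le β
  unfold State.emptyBlocks at h1 h2
  omega

/-- A sync after which something is still pending clears half a block of data for each chosen
pair with an empty block, up to two exceptions. -/
theorem State.sync_progress {σ : State p} (hfull : FullBlocks σ.backend)
    (hcache : σ.cache ⊆ insert 0 (Finset.range p.n)) (S : Choice p)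
    (hne : (σ.sync S).buffer ≠ []) :
    2 * (σ.sync S).pendingBytes + 2 * σ.modified + (S.1 ∩ σ.goodPairs).card * p.blk
        + p.k * p.blk * (σ.sync S).debt ≤
      2 * σ.pendingBytes + 2 * (σ.sync S).modified + p.k * p.blk * σ.debt := by
  have hinv := State.pushed_inv hfull S
  have hp := State.sync_pending hfull S
  have hbig : σ.Big → (σ.sync S).Big := fun h => h.sync hfull S
  have hset : σ.Settled → (σ.sync S).Settled := fun h => (h.sync_and_buffer_eq hfull S).1
  have hle : (σ.pushed S).pendingBytes ≤ σ.pendingBytes := by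
    rw [← σ.queue_size]
    exact sum_size_le_of_sublist hinv.buffer
  -- A poor sync is paid for by the debt: at most `k` good pairs are chosen, and a drop of the debt
  -- by one releases `k * blk`.
  have exception : (¬ σ.Big ∧ (σ.sync S).Big) ∨ (¬ σ.Settled ∧ (σ.sync S).Settled) →
      2 * (σ.sync S).pendingBytes + 2 * σ.modified + (S.1 ∩ σ.goodPairs).card * p.blk
        + p.k * p.blk * (σ.sync S).debt ≤
      2 * σ.pendingBytes + 2 * (σ.sync S).modified + p.k * p.blk * σ.debt := by
    intro h
    have h1 := Nat.mul_le_mul_left (p.k * p.blk) (State.debt_lt_of hbig hset h)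
    have h2 : (S.1 ∩ σ.goodPairs).card * p.blk ≤ p.k * p.blk :=
      Nat.mul_le_mul_right _ ((Finset.card_le_card Finset.inter_subset_left).trans_eq S.2)
    rw [mul_add, mul_one] at h1
    omega
  -- If pushing cleared everything, evictions must have refilled the buffer, which is impossible
  -- from a settled state.
  by_cases hpush : (σ.pushed S).buffer = []
  · by_cases hs : σ.Settled
    · exact absurd ((hs.sync_and_buffer_eq hfull S).2.trans hpush) hne
    · exact exception (.inr ⟨hs, State.settled_sync_of_pushed hfull hcache hpush⟩)
  obtain ⟨y₀, hy₀⟩ := List.exists_mem_of_ne_nil _ hpush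
  have regular : (∀ β ∈ σ.emptyBlocks S, p.blk ≤ 2 * ((σ.pushed S).backend β).used) →
      2 * (σ.sync S).pendingBytes + 2 * σ.modified + (S.1 ∩ σ.goodPairs).card * p.blk
        + p.k * p.blk * (σ.sync S).debt ≤
      2 * σ.pendingBytes + 2 * (σ.sync S).modified + p.k * p.blk * σ.debt := by
    intro h
    have h1 := State.card_mul_blk_le hfull S h
    have h2 := Nat.mul_le_mul_left (p.k * p.blk) (State.debt_le_of hbig hset)
    omega
  -- With only large fragments, a block that was empty and no longer is has received one, hence is
  -- half full.
  by_cases hb : σ.Big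
  · refine regular fun β hβ => ?_
    obtain ⟨hβU, hβE⟩ := Finset.mem_filter.1 hβ
    rcases hinv.big (fun x hx => hb x (σ.queue_perm.subset hx)) β hβE with h | h
    · rw [hinv.nonempty y₀ hy₀ β hβU] at h
      exact absurd h Bool.false_ne_true
    · exact h
  -- Either only large fragments survive, for the first time, or some leftover fragment is below
  -- half a block, and having found no room it shows that all chosen blocks are more than half full.
  · by_cases hb' : ∀ x ∈ (σ.pushed S).buffer, p.blk ≤ 2 * x.size
    · exact exception (.inl ⟨hb, State.Big.of_subset hb' fun _ hx => σ.mem_sync_buffer hx⟩)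
    · push Not at hb'
      obtain ⟨y, hy, hys⟩ := hb'
      refine regular fun β hβ => ?_
      have := hinv.noRoom y hy β (Finset.mem_filter.1 hβ).1
      omega

theorem State.published_eq_table_of_sync {σ : State p} {S : Choice p}
    (h : (σ.sync S).buffer = []) : (σ.sync S).published = (σ.sync S).table := by
  have hev := State.evict_evictStep (σ.pushed S).publish
  have hb : (σ.pushed S).buffer = [] := hev.buffer_eq_nil h
  rw [State.sync_eq, hev.published, hev.table]
  funext f
  simp [State.publish, hb]

/-! ## Invariants of reachable states and of runs -/

/-- The invariants of a running client on which the running time depends. -/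
structure Sound (σ : State p) : Prop where
  full : FullBlocks σ.backend
  cache : σ.cache ⊆ insert 0 (Finset.range p.n)

theorem Sound.opStep {σ σ' : State p} (h : Sound σ) (hs : OpStep σ σ') : Sound σ' :=
  ⟨hs.backend ▸ h.full, hs.cache ▸ h.cache⟩

theorem Sound.sync {σ : State p} (h : Sound σ) (S : Choice p) : Sound (σ.sync S) :=
  ⟨State.sync_fullBlocks h.full S,
    (State.evict_evictStep _).cache.trans (State.sync_cache h.full S h.cache)⟩

theorem Reachable.sound {fmt : Format p} {σ : State p} (h : Reachable fmt σ) : Sound σ := by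
  induction h with
  | init => exact ⟨fun β f d h => by simp [State.init] at h, by simp [State.init]⟩
  | op σ o _ ih => exact ih.opStep (σ.apply_opStep fmt o)
  | sync σ S _ ih => exact ih.sync S

section Run

variable {fmt : Format p} {σ : State p} {τ : ℝ} {P : List TimedOp} {J : ℕ}

theorem run_succ (ω : Fin J → Choice p) {j : ℕ} (h : j < J) :
    ∃ σ', OpStep (run fmt σ τ P ω j) σ' ∧ run fmt σ τ P ω (j + 1) = σ'.sync (ω ⟨j, h⟩) := by
  rw [run, dif_pos h]
  exact ⟨_, State.foldl_apply_opStep fmt _ _, rfl⟩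

theorem run_succ_of_le (ω : Fin J → Choice p) {j : ℕ} (h : J ≤ j) :
    run fmt σ τ P ω (j + 1) = run fmt σ τ P ω j := by
  rw [run, dif_neg (by omega)]

theorem run_succ_of_ops_before (ω : Fin J → Choice p) {j : ℕ} (h : j < J)
    (hP : ∀ o ∈ P, o.time < j * τ) :
    run fmt σ τ P ω (j + 1) = (run fmt σ τ P ω j).sync (ω ⟨j, h⟩) := by
  rw [run, dif_pos h]
  have : (P.filter fun o => decide (j * τ ≤ o.time ∧ o.time < (j + 1) * τ)) = [] := by
    rw [List.filter_eq_nil_iff]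
    intro o ho
    have := hP o ho
    simp only [decide_eq_true_eq]
    rintro ⟨h, -⟩
    linarith
  rw [this]
  rfl

/-- A state depends only on the choices already made. This lets a prefix of the choices serve as the
past in the conditional averages. -/
theorem run_congr {J' : ℕ} (ω : Fin J → Choice p) (ω' : Fin J' → Choice p) (j : ℕ)
    (hJ : j ≤ J) (hJ' : j ≤ J')
    (h : ∀ i (hi : i < j), ω ⟨i, hi.trans_le hJ⟩ = ω' ⟨i, hi.trans_le hJ'⟩) :
    run fmt σ τ P ω j = run fmt σ τ P ω' j := by
  induction j with
  | zero => rfl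
  | succ j ih =>
    rw [run, run, dif_pos (by omega), dif_pos (by omega),
      ih (by omega) (by omega) fun i hi => h i (by omega), h j (by omega)]

theorem run_sound (hσ : Sound σ) (ω : Fin J → Choice p) (j : ℕ) :
    Sound (run fmt σ τ P ω j) := by
  induction j with
  | zero => exact hσ
  | succ j ih =>
    by_cases h : j < J
    · obtain ⟨σ', h1, h2⟩ := run_succ (fmt := fmt) (σ := σ) (τ := τ) (P := P) ω h
      rw [h2]
      exact (ih.opStep h1).sync _
    · rwa [run_succ_of_le ω (by omega)]

theorem run_modified_mono (hσ : Sound σ) (ω : Fin J → Choice p) :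
    Monotone fun j => (run fmt σ τ P ω j).modified := by
  refine monotone_nat_of_le_succ fun j => ?_
  by_cases h : j < J
  · obtain ⟨σ', h1, h2⟩ := run_succ (fmt := fmt) (σ := σ) (τ := τ) (P := P) ω h
    rw [h2]
    exact h1.modified.trans (State.sync_modified ((run_sound hσ ω j).opStep h1).full _)
  · rw [run_succ_of_le ω (by omega)]

theorem run_liveBytes (hσ : Sound σ) (ω : Fin J → Choice p) (j : ℕ) :
    (run fmt σ τ P ω j).liveBytes + (run fmt σ τ P ω j).pendingBytes + σ.modified ≤
      σ.liveBytes + σ.pendingBytes + (run fmt σ τ P ω j).modified := by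
  induction j with
  | zero => exact le_rfl
  | succ j ih =>
    by_cases h : j < J
    · obtain ⟨σ', h1, h2⟩ := run_succ (fmt := fmt) (σ := σ) (τ := τ) (P := P) ω h
      have h3 := State.sync_liveBytes ((run_sound hσ ω j).opStep h1).full (ω ⟨j, h⟩)
      have h4 := h1.liveBytes_le
      have h5 := h1.pending
      rw [h2]
      omega
    · rwa [run_succ_of_le ω (by omega)]

theorem run_pendingBytes (hσ : Sound σ) (ω : Fin J → Choice p) (j : ℕ) :
    (run fmt σ τ P ω j).pendingBytes + σ.modified ≤
      σ.pendingBytes + (run fmt σ τ P ω j).modified := by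
  induction j with
  | zero => exact le_rfl
  | succ j ih =>
    by_cases h : j < J
    · obtain ⟨σ', h1, h2⟩ := run_succ (fmt := fmt) (σ := σ) (τ := τ) (P := P) ω h
      have hfull := ((run_sound hσ ω j).opStep h1).full
      have h3 := State.sync_pending hfull (ω ⟨j, h⟩)
      have h4 := sum_size_le_of_sublist (State.pushed_inv hfull (ω ⟨j, h⟩)).buffer
      rw [σ'.queue_size] at h4
      change (σ'.pushed _).pendingBytes ≤ _ at h4
      have h5 := h1.pending
      rw [h2]
      omega
    · rwa [run_succ_of_le ω (by omega)]

variable (fmt σ τ P) in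
/-- The number of pairs chosen in sync `j + 1` that have an empty block after repacking. -/
noncomputable def gain (ω : Fin J → Choice p) (j : ℕ) : ℕ :=
  if h : j < J then ((ω ⟨j, h⟩).1 ∩ (run fmt σ τ P ω j).goodPairs).card else 0

theorem gain_le (ω : Fin J → Choice p) (j : ℕ) : gain fmt σ τ P ω j ≤ p.k := by
  unfold gain
  split_ifs with h
  · exact (Finset.card_le_card Finset.inter_subset_left).trans_eq (ω ⟨j, h⟩).2
  · exact Nat.zero_le _

/-- The potential of `State.sync_progress` is telescoped over a window without operations. The bytes
pending at its start and those added during it amount to at most `L`, and the debt is at most two.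
-/
theorem sum_gain_le_of_pending (hσ : Sound σ) (hbuffer : σ.buffer = [])
    {L : ℕ} (hbytes : ∀ (J : ℕ) (ω : Fin J → Choice p),
      (run fmt σ τ P ω J).modified ≤ σ.modified + L) (ω : Fin J → Choice p) {a b : ℕ}
    (hab : a ≤ b) (hb : b ≤ J) (hP : ∀ o ∈ P, o.time < a * τ) (hτ : 0 ≤ τ)
    (hne : ∀ j, a ≤ j → j ≤ b → (run fmt σ τ P ω j).buffer ≠ []) :
    (∑ j ∈ Finset.Ico a b, gain fmt σ τ P ω j) * p.blk ≤ 2 * L + 2 * (p.k * p.blk) := by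
  have key : ∀ c, a ≤ c → c ≤ b →
      2 * (run fmt σ τ P ω c).pendingBytes + 2 * (run fmt σ τ P ω a).modified +
        (∑ j ∈ Finset.Ico a c, gain fmt σ τ P ω j) * p.blk +
        p.k * p.blk * (run fmt σ τ P ω c).debt ≤
      2 * (run fmt σ τ P ω a).pendingBytes + 2 * (run fmt σ τ P ω c).modified +
        p.k * p.blk * (run fmt σ τ P ω a).debt := by
    intro c hac
    induction c, hac using Nat.le_induction with
    | base => simp
    | succ c hac ih =>
      intro hcb
      have hcJ : c < J := by omega
      have ih := ih (by omega)
      have hP' : ∀ o ∈ P, o.time < c * τ := fun o ho =>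
        (hP o ho).trans_le (mul_le_mul_of_nonneg_right (by exact_mod_cast hac) hτ)
      have hrun := run_succ_of_ops_before (fmt := fmt) (σ := σ) ω hcJ hP'
      have hs := run_sound (fmt := fmt) (τ := τ) (P := P) hσ ω c
      have hpr := State.sync_progress hs.full hs.cache (ω ⟨c, hcJ⟩)
        (by rw [← hrun]; exact hne _ (by omega) hcb)
      rw [← hrun] at hpr
      have hgain : gain fmt σ τ P ω c =
          ((ω ⟨c, hcJ⟩).1 ∩ (run fmt σ τ P ω c).goodPairs).card := by
        rw [gain, dif_pos hcJ]
      rw [Finset.sum_Ico_succ_top hac, add_mul, hgain]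
      omega
  have h1 := key b hab le_rfl
  have h2 := run_pendingBytes (fmt := fmt) (τ := τ) (P := P) hσ ω a
  have h3 : σ.pendingBytes = 0 := by simp [State.pendingBytes, hbuffer]
  have h4 := (run_modified_mono (fmt := fmt) (τ := τ) (P := P) hσ ω hb).trans (hbytes J ω)
  have h5 := Nat.mul_le_mul_left (p.k * p.blk)
    (State.debt_le_two (run fmt σ τ P ω a))
  simp only at h4
  omega

end Run

/-! ## Random choices -/

/-- Transposing the two pairs is an involution on the choices. -/
theorem card_choice_mem_eq (q q' : Fin p.N) :
    (Finset.univ.filter fun S : Choice p => q ∈ S.1).card =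
      (Finset.univ.filter fun S : Choice p => q' ∈ S.1).card := by
  let swap : Choice p → Choice p := fun S =>
    ⟨S.1.map (Equiv.swap q q').toEmbedding, by rw [Finset.card_map, S.2]⟩
  have hswap : ∀ S, swap (swap S) = S := by
    intro S
    apply Subtype.ext
    ext x
    simp [swap]
  refine Finset.card_nbij' swap swap ?_ ?_ (fun S _ => hswap S) (fun S _ => hswap S)
  · intro S hS
    have hS : q ∈ S.1 := by simpa using hS
    simp only [Finset.coe_filter, Finset.mem_univ, true_and, Set.mem_ofPred_eq]
    exact Finset.mem_map.2 ⟨q, hS, by simp⟩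
  · intro S hS
    have hS : q' ∈ S.1 := by simpa using hS
    simp only [Finset.coe_filter, Finset.mem_univ, true_and, Set.mem_ofPred_eq]
    exact Finset.mem_map.2 ⟨q', hS, by simp⟩

/-- Double counting: by symmetry every pair lies in the same number of choices, and taking all pairs
for `G` determines this number. -/
theorem sum_card_choice_inter (G : Finset (Fin p.N)) :
    p.N * ∑ S : Choice p, (S.1 ∩ G).card = p.k * G.card * Fintype.card (Choice p) := by
  have hN : 0 < p.N := p.k_pos.trans_le p.k_le
  have hcount : ∀ G : Finset (Fin p.N), ∑ S : Choice p, (S.1 ∩ G).card =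
      G.card * (Finset.univ.filter fun S : Choice p => (⟨0, hN⟩ : Fin p.N) ∈ S.1).card := by
    intro G
    have h1 : ∀ S : Choice p, (S.1 ∩ G).card = ∑ q ∈ G, if q ∈ S.1 then 1 else 0 := by
      intro S
      rw [Finset.inter_comm, ← Finset.filter_mem_eq_inter, Finset.card_filter]
    simp only [h1]
    rw [Finset.sum_comm, ← smul_eq_mul, ← Finset.sum_const]
    refine Finset.sum_congr rfl fun q _ => ?_
    rw [← Finset.card_filter]
    exact card_choice_mem_eq _ _
  have huniv := hcount Finset.univ
  have : ∑ S : Choice p, (S.1 ∩ Finset.univ).card = Fintype.card (Choice p) * p.k := by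
    rw [Finset.sum_congr rfl fun S _ => by rw [Finset.inter_univ, S.2], Finset.sum_const,
      smul_eq_mul, Finset.card_univ]
  rw [this, Finset.card_univ, Fintype.card_fin] at huniv
  rw [hcount G]
  calc _ = G.card * (p.N * (Finset.univ.filter
        fun S : Choice p => (⟨0, hN⟩ : Fin p.N) ∈ S.1).card) := by ring
    _ = _ := by rw [← huniv]; ring

/-- If half of all pairs are in `G`, then half of the chosen ones are, on average. -/
theorem sum_choice_weight_le {G : Finset (Fin p.N)} (hG : p.N ≤ 2 * G.card) :
    ∑ S : Choice p, (1 - ((S.1 ∩ G).card / p.k : ℝ) / 2) ≤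
      3 / 4 * Fintype.card (Choice p) := by
  have hk : (0 : ℝ) < p.k := by exact_mod_cast p.k_pos
  have hN : (0 : ℝ) < p.N := by exact_mod_cast p.k_pos.trans_le p.k_le
  have h : (p.N : ℝ) * ∑ S : Choice p, ((S.1 ∩ G).card : ℝ) =
      p.k * G.card * Fintype.card (Choice p) := by exact_mod_cast sum_card_choice_inter G
  have hG' : (p.N : ℝ) ≤ 2 * G.card := by exact_mod_cast hG
  have h2 : (p.k : ℝ) / 2 * Fintype.card (Choice p) ≤
      ∑ S : Choice p, ((S.1 ∩ G).card : ℝ) := by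
    refine le_of_mul_le_mul_left ?_ hN
    rw [h]
    have : (0 : ℝ) ≤ p.k * Fintype.card (Choice p) := by positivity
    nlinarith
  rw [Finset.sum_sub_distrib, ← Finset.sum_div, ← Finset.sum_div, Finset.sum_const,
    Finset.card_univ, nsmul_eq_mul, mul_one]
  have h3 : (1 : ℝ) / 2 * Fintype.card (Choice p) ≤
      (∑ S : Choice p, ((S.1 ∩ G).card : ℝ)) / p.k := by
    rw [le_div_iff₀ hk]
    linarith
  linarith

/-- Expectation of a product of weights that depend on the past choices. -/
theorem sum_prod_weight_le {Ω : Type*} [Fintype Ω]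
    (v : (j : ℕ) → (Fin j → Ω) → Ω → ℝ) (c : ℕ → ℝ) (hv : ∀ j h o, 0 ≤ v j h o)
    (hc0 : ∀ j, 0 ≤ c j)     (hc : ∀ j h, ∑ o, v j h o ≤ c j) (J : ℕ) :
    ∑ ω : Fin J → Ω, ∏ i : Fin J, v i (fun a => ω (Fin.castLE i.2.le a)) (ω i) ≤
      ∏ i ∈ Finset.range J, c i := by
  induction J with
  | zero => simp
  | succ J ih =>
    -- The last choice is split off and summed first: only the last factor depends on it.
    rw [← (Fin.snocEquiv fun _ : Fin (J + 1) => Ω).sum_comp, Fintype.sum_prod_type,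
      Finset.sum_comm, Finset.prod_range_succ]
    have hterm : ∀ (ω : Fin J → Ω) (o : Ω),
        (∏ i : Fin (J + 1), v i (fun a => (Fin.snocEquiv fun _ : Fin (J + 1) => Ω) (o, ω)
          (Fin.castLE i.2.le a)) ((Fin.snocEquiv fun _ : Fin (J + 1) => Ω) (o, ω) i)) =
        (∏ i : Fin J, v i (fun a => ω (Fin.castLE i.2.le a)) (ω i)) * v J ω o := by
      intro ω o
      rw [Fin.prod_univ_castSucc]
      congr 1
      · refine Finset.prod_congr rfl fun i _ => ?_
        simp only [Fin.snocEquiv, Equiv.coe_fn_mk, Fin.snoc_castSucc, Fin.val_castSucc]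
        congr 1
        funext a
        exact Fin.snoc_castSucc (α := fun _ => Ω) o ω (Fin.castLE i.2.le a)
      · simp only [Fin.snocEquiv, Equiv.coe_fn_mk, Fin.snoc_last, Fin.val_last]
        congr 1
        funext a
        exact Fin.snoc_castSucc (α := fun _ => Ω) o ω a
    simp only [hterm, ← Finset.mul_sum]
    calc _ ≤ ∑ ω : Fin J → Ω,
          (∏ i : Fin J, v i (fun a => ω (Fin.castLE i.2.le a)) (ω i)) * c J :=
          Finset.sum_le_sum fun ω _ => mul_le_mul_of_nonneg_left (hc J ω)
            (Finset.prod_nonneg fun i _ => hv _ _ _)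
      _ = (∑ ω : Fin J → Ω,
          ∏ i : Fin J, v i (fun a => ω (Fin.castLE i.2.le a)) (ω i)) * c J := by
          rw [Finset.sum_mul]
      _ ≤ _ := by
          exact mul_le_mul_of_nonneg_right ih (hc0 J)

/-! ## The failure probability -/

/-- The bound `1 ≤ j` makes the state the output of a sync, in which an empty buffer already forces
the published table to be current. -/
theorem buffer_ne_nil_of_not_finishedWithin {fmt : Format p} {σ : State p} {τ : ℝ}
    {P : List TimedOp} {J : ℕ} {T : ℝ} {ω : Fin J → Choice p}
    (h : ¬ FinishedWithin fmt σ τ P T ω) {j : ℕ} (hj : 1 ≤ j) (hjJ : j ≤ J)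
    (hjT : ((j : ℝ) + 1) * τ ≤ T) (hP : ∀ o ∈ P, o.time < j * τ) :
    (run fmt σ τ P ω j).buffer ≠ [] := by
  intro hb
  refine h ⟨j, hjJ, hjT, hP, hb, ?_⟩
  obtain ⟨i, rfl⟩ : ∃ i, j = i + 1 := ⟨j - 1, by omega⟩
  obtain ⟨σ', -, h2⟩ := run_succ (fmt := fmt) (σ := σ) (τ := τ) (P := P) ω
    (show i < J by omega)
  rw [h2] at hb ⊢
  exact State.published_eq_table_of_sync hb

/-- Bernoulli's inequality: on `[0, 1]` the convex function `2^(-x)` lies below its chord. -/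
theorem half_rpow_le {x : ℝ} (h0 : 0 ≤ x) (h1 : x ≤ 1) : (1 / 2 : ℝ) ^ x ≤ 1 - x / 2 := by
  have := rpow_one_add_le_one_add_mul_self (s := -(1 / 2)) (by norm_num) h0 h1
  norm_num at this ⊢
  linarith

/-- The expected weight of the choices, where the weight of a choice decreases with the number
of pairs with an empty block that it hits in the syncs of a window. -/
theorem sum_prod_gain_le {fmt : Format p} {σ : State p} {τ : ℝ} {P : List TimedOp} {L : ℕ}
    (hσ : Sound σ) (hbuffer : σ.buffer = [])
    (hbytes : ∀ (J : ℕ) (ω : Fin J → Choice p),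
      (run fmt σ τ P ω J).modified ≤ σ.modified + L)
    (hcapacity : 2 * (σ.liveBytes + L) ≤ p.N * p.blk) (J : ℕ) (W : Finset ℕ)
    (hW : W ⊆ Finset.range J) :
    ∑ ω : Fin J → Choice p, ∏ j ∈ W, (1 - (gain fmt σ τ P ω j / p.k : ℝ) / 2) ≤
      (3 / 4) ^ W.card * (Fintype.card (Choice p) : ℝ) ^ J := by
  classical
  have hk : (0 : ℝ) < p.k := by exact_mod_cast p.k_pos
  let v : (j : ℕ) → (Fin j → Choice p) → Choice p → ℝ := fun j h S =>
    if j ∈ W then 1 - ((S.1 ∩ (run fmt σ τ P h j).goodPairs).card / p.k : ℝ) / 2 else 1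
  let c : ℕ → ℝ := fun j => (if j ∈ W then 3 / 4 else 1) * Fintype.card (Choice p)
  have hv : ∀ j h S, 0 ≤ v j h S := by
    intro j h S
    simp only [v]
    split_ifs
    · have : ((S.1 ∩ (run fmt σ τ P h j).goodPairs).card : ℝ) ≤ p.k := by
        exact_mod_cast (Finset.card_le_card Finset.inter_subset_left).trans_eq S.2
      have := (div_le_one hk).2 this
      linarith
    · exact zero_le_one
  have hc0 : ∀ j, 0 ≤ c j := by
    intro j
    simp only [c]
    split_ifs <;> positivity
  have hc : ∀ j h, ∑ S, v j h S ≤ c j := by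
    intro j h
    simp only [v, c]
    split_ifs
    -- The live bytes stay below the initial ones plus `L`, whatever the past, so half of the pairs
    -- are good.
    · refine sum_choice_weight_le (State.le_two_mul_card_goodPairs (run_sound hσ h j).full ?_)
      have h1 := run_liveBytes (fmt := fmt) (τ := τ) (P := P) hσ h j
      have h2 := hbytes j h
      have h3 : σ.pendingBytes = 0 := by simp [State.pendingBytes, hbuffer]
      omega
    · simp
  have key := sum_prod_weight_le v c hv hc0 hc J
  have hprod : ∏ i ∈ Finset.range J, c i =
      (3 / 4) ^ W.card * (Fintype.card (Choice p) : ℝ) ^ J := by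
    simp only [c]
    rw [Finset.prod_mul_distrib, Finset.prod_const, Finset.card_range, Finset.prod_ite_mem,
      Finset.prod_const, Finset.inter_eq_right.2 hW]
  rw [hprod] at key
  refine le_trans (le_of_eq (Finset.sum_congr rfl fun ω _ => ?_)) key
  rw [← Finset.inter_eq_right.2 hW, ← Finset.prod_ite_mem,
    ← Fin.prod_univ_eq_prod_range (fun j => if j ∈ W then
      (1 - (gain fmt σ τ P ω j / p.k : ℝ) / 2) else 1)]
  refine Finset.prod_congr rfl fun i _ => ?_
  simp only [v, gain, i.2, dif_pos]
  rw [run_congr ω (fun a => ω (Fin.castLE i.2.le a)) i i.2.le le_rfl fun _ _ => rfl]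

theorem failureProb_nonneg (fmt : Format p) (σ : State p) (τ : ℝ) (P : List TimedOp) (T : ℝ) :
    0 ≤ failureProb fmt σ τ P T := ENNReal.toReal_nonneg

/-- Since `2 * (3/4)^12 < 1`, the term `12 z` absorbs the factor `2^z`. The remaining constant `4 /
(3/4)^3 = 256/27` is below `10`. -/
theorem two_rpow_mul_le {z : ℝ} (hz : 0 ≤ z) (s : ℕ) {m : ℕ}
    (hm : 12 * z + 18 * s - 3 ≤ m) :
    (2 : ℝ) ^ (z + 2) * (3 / 4) ^ m ≤ 10 * ((3 / 4) ^ 18) ^ s := by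
  have h1 : ((3 : ℝ) / 4) ^ m ≤ (3 / 4 : ℝ) ^ (12 * z + 18 * s - 3) := by
    rw [← Real.rpow_natCast]
    exact Real.rpow_le_rpow_of_exponent_ge (by norm_num) (by norm_num) hm
  have h2 : (3 / 4 : ℝ) ^ (12 * z + 18 * s - 3) =
      ((3 / 4) ^ 12 : ℝ) ^ z * ((3 / 4) ^ 18) ^ s / (3 / 4) ^ 3 := by
    rw [Real.rpow_sub (by norm_num), Real.rpow_add (by norm_num),
      Real.rpow_mul (by norm_num), Real.rpow_mul (by norm_num), Real.rpow_natCast]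
    norm_cast
  have h3 : (2 : ℝ) ^ z * ((3 / 4) ^ 12 : ℝ) ^ z ≤ 1 := by
    rw [← Real.mul_rpow (by norm_num) (by norm_num)]
    exact Real.rpow_le_one (by norm_num) (by norm_num) hz
  have h4 : (2 : ℝ) ^ (z + 2) = 4 * 2 ^ z := by
    rw [Real.rpow_add (by norm_num)]
    norm_num
    ring
  calc (2 : ℝ) ^ (z + 2) * (3 / 4) ^ m ≤ (4 * 2 ^ z) *
        (((3 / 4) ^ 12 : ℝ) ^ z * ((3 / 4) ^ 18) ^ s / (3 / 4) ^ 3) := by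
        rw [← h2, h4]
        gcongr
    _ = ((2 : ℝ) ^ z * ((3 / 4) ^ 12 : ℝ) ^ z) * (4 / (3 / 4) ^ 3 * ((3 / 4) ^ 18) ^ s) := by
        ring
    _ ≤ 1 * (10 * ((3 / 4) ^ 18) ^ s) := by
        gcongr
        norm_num
    _ = _ := one_mul _

/-- Markov's inequality for the product of weights over the syncs between the last operation and
time `T`. -/
theorem failureProb_le {fmt : Format p} {σ : State p} {τ t : ℝ} {P : List TimedOp} {L : ℕ}
    (hσ : Sound σ) (hbuffer : σ.buffer = []) (hτ : 0 < τ) (ht : 0 ≤ t)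
    (hcapacity : 2 * (σ.liveBytes + L) ≤ p.N * p.blk)
    (hP : IsFSequence fmt σ τ L t P) {s : ℕ} (hs : 1 ≤ s) :
    failureProb fmt σ τ P (t + 48 * L * τ / (p.B * p.k) + 18 * s * τ) ≤
      10 * ((3 / 4) ^ 18) ^ s := by
  classical
  have hk : (0 : ℝ) < p.k := by exact_mod_cast p.k_pos
  have hblk : (0 : ℝ) < p.blk := by exact_mod_cast p.blk_pos
  set T : ℝ := t + 48 * L * τ / (p.B * p.k) + 18 * s * τ with hT
  -- As `B = 2 * blk`, the term `48 L / (B k)` in the running time equals `12 z`.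
  set z : ℝ := 2 * L / (p.blk * p.k) with hz
  have hz0 : 0 ≤ z := by positivity
  have hTτ : T / τ = t / τ + 12 * z + 18 * s := by
    rw [hT, hz, Params.B]
    push_cast
    field_simp
    ring
  set J := ⌊T / τ⌋₊ with hJ
  set a := ⌊t / τ⌋₊ with ha
  have htτ : 0 ≤ t / τ := div_nonneg ht hτ.le
  have hs' : (1 : ℝ) ≤ s := by exact_mod_cast hs
  have hJT : (J : ℝ) ≤ T / τ := Nat.floor_le (by rw [hTτ]; positivity)
  have hJlt : T / τ < J + 1 := Nat.lt_floor_add_one _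
  have hat : (a : ℝ) ≤ t / τ := Nat.floor_le htτ
  have halt : t / τ < a + 1 := Nat.lt_floor_add_one _
  have haJ : a + 2 ≤ J := by
    have : (a : ℝ) + 2 ≤ J := by linarith
    exact_mod_cast this
  have hbefore : ∀ j : ℕ, a + 1 ≤ j → ∀ o ∈ P, o.time < j * τ := by
    intro j hj o ho
    have h1 : (a : ℝ) + 1 ≤ j := by exact_mod_cast hj
    calc o.time ≤ t := hP.le o ho
      _ < (a + 1) * τ := (div_lt_iff₀ hτ).1 halt
      _ ≤ j * τ := by gcongr
  -- All operations precede time `(a + 1) * τ`, and the output of a sync appears one tick later, so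
  -- the last state that counts is `J - 1`. These two ends and the rounding of `T / τ` cost the `3`
  -- in the bound on `W.card`.
  set W := Finset.Ico (a + 1) (J - 1) with hW
  have hWcard : 12 * z + 18 * s - 3 ≤ (W.card : ℝ) := by
    have h1 : (W.card : ℝ) + (a + 2) = J := by
      rw [hW, Nat.card_Ico]
      exact_mod_cast (show J - 1 - (a + 1) + (a + 2) = J by omega)
    linarith
  have hWJ : W ⊆ Finset.range J := by
    intro j hj
    have := Finset.mem_Ico.1 hj
    exact Finset.mem_range.2 (by omega)
  set bad : Finset (Fin J → Choice p) :=
    Finset.univ.filter fun ω => ¬ FinishedWithin fmt σ τ P T ω with hbad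
  have hweight : ∀ ω ∈ bad, (1 / 2 : ℝ) ^ (z + 2) ≤
      ∏ j ∈ W, (1 - (gain fmt σ τ P ω j / p.k : ℝ) / 2) := by
    intro ω hω
    have hfail := (Finset.mem_filter.1 hω).2
    have hsum := sum_gain_le_of_pending hσ hbuffer hP.bytes ω (a := a + 1) (b := J - 1)
      (by omega) (by omega) (hbefore _ le_rfl) hτ.le (by
        intro j hj hjJ
        refine buffer_ne_nil_of_not_finishedWithin hfail (by omega) (by omega) ?_ (hbefore j hj)
        have h1 : (j : ℝ) + 1 ≤ J := by exact_mod_cast (show j + 1 ≤ J by omega)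
        exact (mul_le_mul_of_nonneg_right (h1.trans hJT) hτ.le).trans_eq
          (div_mul_cancel₀ T hτ.ne'))
    have hle : ∑ j ∈ W, (gain fmt σ τ P ω j / p.k : ℝ) ≤ z + 2 := by
      have hsum' : (∑ j ∈ W, (gain fmt σ τ P ω j : ℝ)) * p.blk ≤
          2 * L + 2 * (p.k * p.blk) := by exact_mod_cast hsum
      rw [← Finset.sum_div, div_le_iff₀ hk, ← mul_le_mul_iff_left₀ hblk]
      refine hsum'.trans_eq ?_
      rw [hz]
      field_simp
    calc (1 / 2 : ℝ) ^ (z + 2) ≤ (1 / 2) ^ (∑ j ∈ W, (gain fmt σ τ P ω j / p.k : ℝ)) :=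
          Real.rpow_le_rpow_of_exponent_ge (by norm_num) (by norm_num) hle
      _ = ∏ j ∈ W, (1 / 2 : ℝ) ^ (gain fmt σ τ P ω j / p.k : ℝ) :=
          Real.rpow_sum_of_pos (by norm_num) _ _
      _ ≤ _ := by
          refine Finset.prod_le_prod (fun j _ => by positivity) fun j _ => ?_
          refine half_rpow_le (by positivity) ((div_le_one hk).2 ?_)
          exact_mod_cast gain_le ω j
  have hnonneg : ∀ ω : Fin J → Choice p,
      0 ≤ ∏ j ∈ W, (1 - (gain fmt σ τ P ω j / p.k : ℝ) / 2) := by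
    refine fun ω => Finset.prod_nonneg fun j _ => ?_
    have h1 : (gain fmt σ τ P ω j : ℝ) ≤ p.k := by exact_mod_cast gain_le ω j
    have := (div_le_one hk).2 h1
    linarith
  have hcard : (bad.card : ℝ) * (1 / 2) ^ (z + 2) ≤
      (3 / 4) ^ W.card * (Fintype.card (Choice p) : ℝ) ^ J := by
    refine le_trans ?_ (sum_prod_gain_le hσ hbuffer hP.bytes hcapacity J W hWJ)
    rw [← nsmul_eq_mul]
    exact (Finset.card_nsmul_le_sum _ _ _ hweight).trans
      (Finset.sum_le_univ_sum_of_nonneg hnonneg)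
  have hprob : failureProb fmt σ τ P T =
      bad.card / (Fintype.card (Choice p) : ℝ) ^ J := by
    unfold failureProb
    rw [PMF.toOuterMeasure_uniformOfFintype_apply, ENNReal.toReal_div, ENNReal.toReal_natCast,
      ENNReal.toReal_natCast]
    congr 1
    · rw [hbad, Fintype.card_subtype]
      rfl
    · rw [Fintype.card_fun, Fintype.card_fin]
      push_cast
      rfl
  have hΩ : (0 : ℝ) < (Fintype.card (Choice p) : ℝ) ^ J := by
    have : 0 < Fintype.card (Choice p) := Fintype.card_pos
    positivity
  refine le_trans ?_ (two_rpow_mul_le hz0 s hWcard)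
  rw [hprob, div_le_iff₀ hΩ]
  have h2 : (2 : ℝ) ^ (z + 2) * (1 / 2) ^ (z + 2) = 1 := by
    rw [← Real.mul_rpow (by norm_num) (by norm_num)]
    norm_num
  calc (bad.card : ℝ) = 2 ^ (z + 2) * (bad.card * (1 / 2) ^ (z + 2)) := by
        rw [mul_left_comm, h2, mul_one]
    _ ≤ 2 ^ (z + 2) * ((3 / 4) ^ W.card * (Fintype.card (Choice p) : ℝ) ^ J) := by gcongr
    _ = _ := by ring

theorem negligible_of_le {f : ℕ → ℝ} {r C : ℝ} (hr0 : 0 ≤ r) (hr1 : r < 1)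
    (h0 : ∀ s, 0 ≤ f s) (h : ∀ s, 1 ≤ s → f s ≤ C * r ^ s) : Negligible f := by
  intro k
  have h1 : Filter.Tendsto (fun s : ℕ => C * ((s : ℝ) ^ k * r ^ s)) Filter.atTop (nhds 0) := by
    simpa using (tendsto_pow_const_mul_const_pow_of_lt_one k hr0 hr1).const_mul C
  refine squeeze_zero' (Filter.Eventually.of_forall fun s =>
    mul_nonneg (by positivity) (h0 s)) ?_ h1
  filter_upwards [Filter.eventually_ge_atTop 1] with s hs
  calc (s : ℝ) ^ k * f s ≤ (s : ℝ) ^ k * (C * r ^ s) := by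
        gcongr
        exact h s hs
    _ = _ := by ring

/-! ## Polynomial bounds -/

theorem PolyBounded.mono {f g : ℕ → ℕ} (hg : PolyBounded g) (h : ∀ s, f s ≤ g s) :
    PolyBounded f := by
  obtain ⟨q, hq⟩ := hg
  exact ⟨q, fun s => (h s).trans (hq s)⟩

theorem PolyBounded.const (c : ℕ) : PolyBounded fun _ => c :=
  ⟨Polynomial.C c, fun s => by simp⟩

theorem PolyBounded.add {f g : ℕ → ℕ} (hf : PolyBounded f) (hg : PolyBounded g) :
    PolyBounded fun s => f s + g s := by
  obtain ⟨q, hq⟩ := hf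
  obtain ⟨r, hr⟩ := hg
  exact ⟨q + r, fun s => by simpa using add_le_add (hq s) (hr s)⟩

theorem PolyBounded.mul {f g : ℕ → ℕ} (hf : PolyBounded f) (hg : PolyBounded g) :
    PolyBounded fun s => f s * g s := by
  obtain ⟨q, hq⟩ := hf
  obtain ⟨r, hr⟩ := hg
  exact ⟨q * r, fun s => by simpa using Nat.mul_le_mul (hq s) (hr s)⟩

/-! ## Left-or-right queries with fixed messages -/

theorem map_getD_range {α : Type*} (l : List α) (d : α) :
    (List.range l.length).map (fun i => l.getD i d) = l := by
  refine List.ext_getElem (by simp) fun i h1 h2 => ?_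
  simp [List.getD_eq_getElem?_getD, h2]

/-- The query for two fixed messages of the same length. -/
def fixedQuery (m m' : List Bool) : LRQuery where
  gates := [.const false, .const true]
  left := (List.range m.length).map fun i => if m.getD i false then 1 else 0
  right := (List.range m.length).map fun i => if m'.getD i false then 1 else 0
  same_length := by simp

theorem fixedQuery_message (m m' : List Bool) (h : m.length = m'.length) (side : Bool)
    (answers : List (List Bool)) :
    (fixedQuery m m').message side answers = if side then m' else m := by
  -- The constants `false` and `true` are gates `0` and `1`, so the wire number encodes the bit.
  have key : ∀ b : Bool, [false, true].getD (if b then 1 else 0) false = b := by decide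
  have hgates : evalGates (cpaInput answers) (fixedQuery m m').gates = [false, true] := by
    simp [fixedQuery, evalGates, Gate.eval]
  unfold LRQuery.message
  simp only [hgates]
  cases side
  · simp only [fixedQuery, Bool.false_eq_true, if_false, List.map_map, Function.comp_def, key]
    exact map_getD_range m false
  · simp only [fixedQuery, if_true, List.map_map, Function.comp_def, key, h]
    exact map_getD_range m' false

noncomputable section

/-- Encrypt messages one after the other. -/
def encryptMessages (E : SymEnc) (sec : ℕ) (κ : E.Key sec) :
    List (List Bool) → PMF (List (List Bool))
  | [] => PMF.pure []
  | m :: ms => (E.enc sec κ m).bind fun c => (encryptMessages E sec κ ms).map (c :: ·)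

/-- The messages ignore earlier answers, so the oracle just encrypts one of the two lists in order.
-/
theorem oracle_fixedQuery (E : SymEnc) (sec : ℕ) (κ : E.Key sec) (side : Bool) :
    ∀ (ms ms' answers : List (List Bool)), ms.map List.length = ms'.map List.length →
      E.oracle sec κ side (List.zipWith fixedQuery ms ms') answers =
        (encryptMessages E sec κ (if side then ms' else ms)).map (answers ++ ·)
  | [], [], answers, _ => by
    simp [SymEnc.oracle, encryptMessages, PMF.pure_map]
  | [], _ :: _, _, h => by simp at h
  | _ :: _, [], _, h => by simp at h
  | m :: ms, m' :: ms', answers, h => by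
    simp only [List.map_cons, List.cons.injEq] at h
    have ih := fun answers => oracle_fixedQuery E sec κ side ms ms' answers h.2
    rw [List.zipWith_cons_cons, SymEnc.oracle, fixedQuery_message m m' h.1]
    have hsplit : (if side then m' :: ms' else m :: ms) =
        (if side then m' else m) :: (if side then ms' else ms) := by cases side <;> rfl
    rw [hsplit, encryptMessages, PMF.map_bind]
    congr 1
    funext c
    rw [ih, PMF.map_comp]
    congr 1
    funext cs
    simp

/-! ## From access patterns to ciphertexts -/

/-- Time and file of an access. -/
def Access.shape (a : Access p) : ℝ × Option (Fin p.N) := (a.time, a.file)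

/-- The accesses with given times and files that write given bit strings. -/
def attach (shape : List (ℝ × Option (Fin p.N))) (cs : List (List Bool)) : List (Access p) :=
  shape.mapIdx fun i s => ⟨s.1, s.2, cs.getD i []⟩

theorem encryptAll_eq (E : SymEnc) (sec : ℕ) (κ : E.Key sec) (w : List (Access p)) :
    encryptAll E sec κ w =
      (encryptMessages E sec κ (w.map Access.payload)).map (attach (w.map Access.shape)) := by
  induction w with
  | nil => simp [encryptAll, encryptMessages, PMF.pure_map, attach]
  | cons a w ih =>
    rw [encryptAll, List.map_cons, List.map_cons, encryptMessages, PMF.map_bind]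
    congr 1
    funext c
    rw [ih, PMF.map_comp, PMF.map_comp]
    congr 1
    funext cs
    simp [attach, List.mapIdx_cons, Access.shape]

open Classical in
/-- A gate that reads access patterns, for ciphertexts with known times and files. -/
def cpaGate (shape : List (ℝ × Option (Fin p.N))) : Gate (AccessAtom p) → Gate CPAAtom
  | .input (.present a) => .const (decide (a < shape.length))
  | .input (.time a x) => .const (decide (shape[a]?.map Prod.fst = some x))
  | .input (.file a f) => .const (decide (shape[a]?.map Prod.snd = some f))
  | .input (.bit a i v) => if a < shape.length then .input (a, i, v) else .const false
  | .const b => .const b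
  | .nand i j => .nand i j

/-- Times and files are known constants, so only payload bits are read from the oracle's answers.
Missing ciphertexts default to `[]` on both sides, so no length condition on `cs` is needed. -/
theorem cpaGate_eval (shape : List (ℝ × Option (Fin p.N))) (cs : List (List Bool))
    (vs : List Bool) (g : Gate (AccessAtom p)) :
    (cpaGate shape g).eval (cpaInput cs) vs = g.eval (accessInput (attach shape cs)) vs := by
  cases g with
  | input x =>
    cases x with
    | present a => simp [cpaGate, Gate.eval, accessInput, attach]
    | time a x =>
      simp [cpaGate, Gate.eval, accessInput, attach, List.getElem?_mapIdx, Function.comp_def]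
    | file a f =>
      simp only [cpaGate, Gate.eval, accessInput, decide_eq_decide]
      simp [attach, List.getElem?_mapIdx, Function.comp_def]
    | bit a i v =>
      by_cases h : a < shape.length
      · simp [cpaGate, Gate.eval, accessInput, attach, cpaInput, h]
      · simp [cpaGate, Gate.eval, accessInput, attach, h]
  | const b => rfl
  | nand i j => rfl

def cpaCircuit (shape : List (ℝ × Option (Fin p.N))) (D : Circuit (AccessAtom p)) :
    Circuit CPAAtom := ⟨D.gates.map (cpaGate shape), D.out⟩

theorem cpaCircuit_eval (shape : List (ℝ × Option (Fin p.N))) (cs : List (List Bool))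
    (D : Circuit (AccessAtom p)) :
    (cpaCircuit shape D).eval (cpaInput cs) = D.eval (accessInput (attach shape cs)) := by
  simp only [Circuit.eval, cpaCircuit, evalGates, List.foldl_map, cpaGate_eval]

/-- The chosen-plaintext adversary that runs a distinguisher on the encryption of one of two
fixed lists of accesses. -/
def cpaAdversary (w w' : List (Access p)) (D : Circuit (AccessAtom p)) : CPAAdversary where
  queries := List.zipWith fixedQuery (w.map Access.payload) (w'.map Access.payload)
  guess := cpaCircuit (w.map Access.shape) D

theorem cpaGame_cpaAdversary (E : SymEnc) (sec : ℕ) {w w' : List (Access p)}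
    (D : Circuit (AccessAtom p)) (hshape : w.map Access.shape = w'.map Access.shape)
    (hlength : (w.map Access.payload).map List.length = (w'.map Access.payload).map List.length)
    (side : Bool) :
    E.cpaGame sec (cpaAdversary w w' D) side =
      ((E.gen sec).bind fun κ => encryptAll E sec κ (if side then w' else w)).map
        fun v => D.eval (accessInput v) := by
  rw [SymEnc.cpaGame, PMF.map_bind]
  congr 1
  funext κ
  rw [cpaAdversary, oracle_fixedQuery E sec κ side _ _ _ hlength, encryptAll_eq, PMF.map_comp,
    PMF.map_comp]
  cases side
  · simp only [Bool.false_eq_true, if_false]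
    congr 1
    funext cs
    simp [cpaCircuit_eval]
  -- The circuit hardwires the shape of `w`; on the right side it is correct because `w'` has the
  -- same shape.
  · simp only [if_true, ← hshape]
    congr 1
    funext cs
    simp [cpaCircuit_eval]

theorem cpaAdversary_size_le {w w' : List (Access p)} (D : Circuit (AccessAtom p)) {M : ℕ}
    (hM : ∀ a ∈ w, a.payload.length ≤ M) :
    (cpaAdversary w w' D).size ≤ w.length * (3 + 2 * M) + D.size := by
  -- A query costs `1`, its two constant gates, and two wire lists of length at most `M`.
  have key : ∀ ms ms' : List (List Bool), (∀ m ∈ ms, m.length ≤ M) →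
      ((List.zipWith fixedQuery ms ms').map fun q =>
        1 + q.gates.length + q.left.length + q.right.length).sum ≤ ms.length * (3 + 2 * M) := by
    intro ms
    induction ms with
    | nil => simp
    | cons m ms ih =>
      intro ms' h
      cases ms' with
      | nil => simp
      | cons m' ms' =>
        have h1 := ih ms' fun x hx => h x (by simp [hx])
        have h2 := h m (by simp)
        rw [List.zipWith_cons_cons, List.map_cons, List.sum_cons, List.length_cons, add_mul]
        simp only [fixedQuery, List.length_map, List.length_range, List.length_cons,
          List.length_nil] at h1 ⊢
        omega
  have := key (w.map Access.payload) (w'.map Access.payload) (by simpa using hM)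
  simp only [CPAAdversary.size, cpaAdversary, Circuit.size, cpaCircuit, List.length_map] at this ⊢
  omega

/-! ## Plaintext access patterns -/

section Plain

variable (fmt : Format p) (σ : State p) (τ : ℝ) {J : ℕ} (ω : Fin J → Choice p)

/-- The schedule and the chosen pairs come from `τ` and `ω` alone; the operations influence only
payloads. -/
theorem plainAccesses_shape (P P' : List TimedOp) :
    (plainAccesses fmt σ τ P ω).map Access.shape =
      (plainAccesses fmt σ τ P' ω).map Access.shape := by
  simp [plainAccesses, List.map_flatMap, Access.shape, superAccess, pairAccess,
    Function.comp_def]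

theorem plainAccesses_payload_length (P P' : List TimedOp) :
    ((plainAccesses fmt σ τ P ω).map Access.payload).map List.length =
      ((plainAccesses fmt σ τ P' ω).map Access.payload).map List.length := by
  simp [plainAccesses, List.map_flatMap, superAccess, pairAccess, Function.comp_def,
    fmt.pairBits_length, fmt.superBits_length]

theorem plainAccesses_payload_length_le (P : List TimedOp) :
    ∀ a ∈ plainAccesses fmt σ τ P ω, a.payload.length ≤ fmt.superLen + fmt.pairLen := by
  have h1 : ∀ σ' x, (superAccess fmt σ' x).payload.length ≤ fmt.superLen + fmt.pairLen :=
    fun σ' x => (fmt.superBits_length _).trans_le (Nat.le_add_right _ _)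
  have h2 : ∀ σ' x q, (pairAccess fmt σ' x q).payload.length ≤ fmt.superLen + fmt.pairLen :=
    fun σ' x q => (fmt.pairBits_length _ _).trans_le (Nat.le_add_left _ _)
  intro a ha
  simp only [plainAccesses, List.mem_append, List.mem_cons, List.mem_map, List.mem_flatMap] at ha
  rcases ha with (rfl | ⟨q, -, rfl⟩) | ⟨j, -, rfl | ⟨q, -, rfl⟩⟩
  · exact h1 _ _
  · exact h2 _ _ _
  · exact h1 _ _
  · exact h2 _ _ _

/-- The snapshot has `N + 1` writes and each sync `k + 1 ≤ N + 1`. -/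
theorem plainAccesses_length_le (P : List TimedOp) :
    (plainAccesses fmt σ τ P ω).length ≤ (J + 1) * (p.N + 1) := by
  have hk := Nat.mul_le_mul_left J p.k_le
  simp only [plainAccesses, List.length_append, List.length_cons, List.length_map,
    List.length_finRange, List.length_flatMap, Finset.length_sort, (ω _).2, List.map_const',
    List.sum_replicate, smul_eq_mul]
  nlinarith

end Plain

/-! ## Indistinguishability -/

theorem toReal_uniform_bind {Ω : Type*} [Fintype Ω] [Nonempty Ω] (f : Ω → PMF Bool) (b : Bool) :
    (((PMF.uniformOfFintype Ω).bind f) b).toReal =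
      (Fintype.card Ω : ℝ)⁻¹ * ∑ ω, (f ω b).toReal := by
  rw [PMF.bind_apply, tsum_fintype, ENNReal.toReal_sum fun ω _ =>
    ENNReal.mul_ne_top (PMF.apply_ne_top _ _) (PMF.apply_ne_top _ _), Finset.mul_sum]
  refine Finset.sum_congr rfl fun ω _ => ?_
  simp [ENNReal.toReal_mul]

/-- The distinguishing advantage for two mixtures is at most that for some component. -/
theorem exists_abs_sub_uniform_bind_le {Ω : Type*} [Fintype Ω] [Nonempty Ω]
    (f g : Ω → PMF Bool) (b : Bool) :
    ∃ ω, |(((PMF.uniformOfFintype Ω).bind f) b).toReal -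
        (((PMF.uniformOfFintype Ω).bind g) b).toReal| ≤ |(f ω b).toReal - (g ω b).toReal| := by
  obtain ⟨ω, -, hω⟩ := Finset.exists_max_image Finset.univ
    (fun ω => |(f ω b).toReal - (g ω b).toReal|) Finset.univ_nonempty
  refine ⟨ω, ?_⟩
  have hpos : (0 : ℝ) < Fintype.card Ω := by exact_mod_cast Fintype.card_pos
  rw [toReal_uniform_bind, toReal_uniform_bind, ← mul_sub, ← Finset.sum_sub_distrib, abs_mul,
    abs_of_pos (inv_pos.2 hpos), inv_mul_le_iff₀ hpos]
  calc _ ≤ ∑ ω, |(f ω b).toReal - (g ω b).toReal| := Finset.abs_sum_le_sum_abs _ _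
    _ ≤ ∑ _ : Ω, |(f ω b).toReal - (g ω b).toReal| :=
        Finset.sum_le_sum fun ω' h => hω ω' h
    _ = _ := by rw [Finset.sum_const, Finset.card_univ, nsmul_eq_mul]

/-- Key and choices are independent, so the choices can be drawn first and the output becomes a
uniform mixture over them. -/
theorem accessPattern_map (E : SymEnc) (sec : ℕ) (fmt : Format p) (σ : State p) (τ : ℝ)
    (P : List TimedOp) (J : ℕ) (D : Circuit (AccessAtom p)) :
    ((accessPattern E sec fmt σ τ P J).map fun w => D.eval (accessInput w)) =
      (PMF.uniformOfFintype (Fin J → Choice p)).bind fun ω =>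
        ((E.gen sec).bind fun κ => encryptAll E sec κ (plainAccesses fmt σ τ P ω)).map
          fun w => D.eval (accessInput w) := by
  rw [accessPattern, PMF.bind_comm, PMF.map_bind]

theorem Negligible.of_abs_le {f g : ℕ → ℝ} (hg : Negligible g)
    (h : ∀ s, |f s| ≤ g s) : Negligible f := by
  refine Asymptotics.SuperpolynomialDecay.trans_abs_le hg fun s => ?_
  exact (h s).trans (le_abs_self _)

theorem compIndist_accessPattern {E : SymEnc} (hE : E.INDCPA) {par : ℕ → Params}
    (fmt : (sec : ℕ) → Format (par sec)) (σ : (sec : ℕ) → State (par sec)) (τ : ℕ → ℝ)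
    (hN : PolyBounded fun sec => (par sec).N)
    (hpair : PolyBounded fun sec => (fmt sec).pairLen)
    (hsuper : PolyBounded fun sec => (fmt sec).superLen)
    (P₀ P₁ : ℕ → List TimedOp) {J : ℕ → ℕ} (hJ : PolyBounded J) :
    CompIndist (fun sec => accessPattern E sec (fmt sec) (σ sec) (τ sec) (P₀ sec) (J sec))
      (fun sec => accessPattern E sec (fmt sec) (σ sec) (τ sec) (P₁ sec) (J sec)) := by
  intro D hD
  -- Non-uniformity is used here: the best choices for each security parameter become part of the
  -- adversary.
  choose ω hω using fun sec => exists_abs_sub_uniform_bind_le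
    (fun ω : Fin (J sec) → Choice (par sec) => ((E.gen sec).bind fun κ => encryptAll E sec κ
      (plainAccesses (fmt sec) (σ sec) (τ sec) (P₀ sec) ω)).map
        fun w => (D sec).eval (accessInput w))
    (fun ω : Fin (J sec) → Choice (par sec) => ((E.gen sec).bind fun κ => encryptAll E sec κ
      (plainAccesses (fmt sec) (σ sec) (τ sec) (P₁ sec) ω)).map
        fun w => (D sec).eval (accessInput w)) true
  let A : ℕ → CPAAdversary := fun sec => cpaAdversary
    (plainAccesses (fmt sec) (σ sec) (τ sec) (P₀ sec) (ω sec))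
    (plainAccesses (fmt sec) (σ sec) (τ sec) (P₁ sec) (ω sec)) (D sec)
  have hA : PolyBounded fun sec => (A sec).size := by
    refine PolyBounded.mono ((((hJ.add (.const 1)).mul (hN.add (.const 1))).mul
      ((PolyBounded.const 3).add ((PolyBounded.const 2).mul (hsuper.add hpair)))).add hD)
      fun sec => ?_
    refine (cpaAdversary_size_le (D sec)
      (plainAccesses_payload_length_le (fmt sec) (σ sec) (τ sec) (ω sec) (P₀ sec))).trans ?_
    exact Nat.add_le_add_right (Nat.mul_le_mul_right _
      (plainAccesses_length_le (fmt sec) (σ sec) (τ sec) (ω sec) (P₀ sec))) _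
  refine (hE A hA).of_abs_le fun sec => ?_
  rw [abs_abs, accessPattern_map, accessPattern_map]
  refine (hω sec).trans_eq ?_
  have hgame := cpaGame_cpaAdversary E sec (D sec)
    (plainAccesses_shape (fmt sec) (σ sec) (τ sec) (ω sec) (P₀ sec) (P₁ sec))
    (plainAccesses_payload_length (fmt sec) (σ sec) (τ sec) (ω sec) (P₀ sec) (P₁ sec))
  simp only [A, hgame]
  rfl

end

end ObliviSync

/-! ### Running time and indistinguishability combined -/

open ObliviSync in
theorem theorem2 (C : Client) (hE : C.scheme.INDCPA)
    (hN : PolyBounded fun sec => (C.par sec).N)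
    (hpair : PolyBounded fun sec => (C.fmt sec).pairLen)
    (hsuper : PolyBounded fun sec => (C.fmt sec).superLen)
    (hstart : ∀ sec, Reachable (C.fmt sec) (C.start sec))
    (hbuffer : ∀ sec, (C.start sec).buffer = [])
    (hdrip : ∀ sec, 0 < C.drip sec)
    (L : ℕ → ℕ) (t : ℕ → ℝ) (ht : ∀ sec, 0 ≤ t sec)
    (hcapacity : ∀ sec,
      ((C.start sec).liveBytes + L sec : ℝ) ≤ (C.par sec).N * (C.par sec).B / 4) :
    C.WriteOnlyStronglyOblivious L t fun sec =>
      t sec + 48 * L sec * C.drip sec / ((C.par sec).B * (C.par sec).k)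
        + 18 * sec * C.drip sec := by
  intro P₀ P₁ h₀ h₁
  -- With `B = 2 * blk`, the capacity `N * B / 4` is half a block per pair.
  have hcap : ∀ sec, 2 * ((C.start sec).liveBytes + L sec) ≤
      (C.par sec).N * (C.par sec).blk := by
    intro sec
    have h := hcapacity sec
    rw [Params.B] at h
    push_cast at h
    have : (2 : ℝ) * ((C.start sec).liveBytes + L sec) ≤ (C.par sec).N * (C.par sec).blk := by
      linarith
    exact_mod_cast this
  have hfail : ∀ P : ℕ → List TimedOp, (∀ sec, IsFSequence (C.fmt sec) (C.start sec)
      (C.drip sec) (L sec) (t sec) (P sec)) → Negligible fun sec =>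
        failureProb (C.fmt sec) (C.start sec) (C.drip sec) (P sec)
          (t sec + 48 * L sec * C.drip sec / ((C.par sec).B * (C.par sec).k)
            + 18 * sec * C.drip sec) := fun P hP =>
    negligible_of_le (r := (3 / 4) ^ 18) (C := 10) (by norm_num) (by norm_num)
      (fun sec => failureProb_nonneg _ _ _ _ _)
      fun sec hs => failureProb_le (hstart sec).sound (hbuffer sec) (hdrip sec) (ht sec)
        (hcap sec) (hP sec) hs
  exact ⟨hfail P₀ h₀, hfail P₁ h₁, fun J hJ =>
    compIndist_accessPattern hE C.fmt C.start C.drip hN hpair hsuper P₀ P₁ hJ⟩
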